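/- There exist numerical constants $C^{(2)},C^{(3)}>0$ such that the following holds. Let $k\ge 2$ be an integer, $0<\rho<1$, and let $\mu_0,\mu_1,\dots,\mu_k$ be probability distributions on the same measurable space $\Omega$ such that $(1-\rho)\mu_0(E)\le \mu_i(E)\le (1+\rho)\mu_0(E)$ for every event $E$ and every $1\le i\le k$. Assume that there is an integer $n\ge 1$ with $n\le C^{(2)}/(\rho^2\log k)$ and \[ \sum_{S\subseteq\{1,\dots,k\},\ |S|\ge 2} n^{-|S|/2}\rho^{-|S|}\left|\mathbb{E}_{A\sim\mu_0}\prod_{i\in S}\left(\frac{d\mu_i}{d\mu_0}(A)-1\right)\right|\le \frac1n . \] Let $t,s,\ell\ge 1$ be integers, and consider any algorithm that makes $\ell$ passes over $t$ samples with $s$ bits of memory: for $x_1,\dots,x_t\in\Omega$ it starts from a fixed $u_1\in\{0,1\}^s$, computes $u_{j+1}=f_j(y_j,u_j)\in\{0,1\}^s$ for $1\le j\le t\ell$, where $y_1,\dots,y_{t\ell}$ consists of $\ell$ consecutive copies of $x_1,\dots,x_t$ and the $f_j$ are arbitrary (measurable) functions, and outputs an element of $\{1,\dots,k\}$ that is a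 function of $u_{t\ell+1}$. If, for every $1\le i\le k$, the algorithm outputs $i$ with probability at least $2/3$ when $x_1,\dots,x_t$ are drawn i.i.d. from $\mu_i$, then \[ ts\ell\ \ge\ \frac{k}{C^{(3)}\rho^2\log k}. \] -/

import Mathlib

open MeasureTheory

/-- `μ₁, …, μ_k` (indexed by `Fin k`) is a `ρ`-centered family of distributions, centered
around the distribution `μ₀`. -/
structure IsCenteredFamily {Ω : Type*} [MeasurableSpace Ω] {k : ℕ}
    (ρ : ℝ) (μ₀ : Measure Ω) (μ : Fin k → Measure Ω) : Prop where
  two_le : 2 ≤ k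
  rho_pos : 0 < ρ
  rho_lt_one : ρ < 1
  prob_center : IsProbabilityMeasure μ₀
  prob : ∀ i, IsProbabilityMeasure (μ i)
  lower : ∀ i, ∀ E, MeasurableSet E → (1 - ρ) * μ₀.real E ≤ (μ i).real E
  upper : ∀ i, ∀ E, MeasurableSet E → (μ i).real E ≤ (1 + ρ) * μ₀.real E

/-- The mixed central moment `𝔼_{A ∼ μ₀} ∏_{i ∈ S} (μ_i(A) / μ₀(A) - 1)`, where
`μ_i(A) / μ₀(A)` is the density (Radon–Nikodym derivative) of `μ_i` with respect to `μ₀`. -/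
noncomputable def highOrderCorr {Ω : Type*} [MeasurableSpace Ω] {k : ℕ}
    (μ₀ : Measure Ω) (μ : Fin k → Measure Ω) (S : Finset (Fin k)) : ℝ :=
  ∫ A, ∏ i ∈ S, (((μ i).rnDeriv μ₀ A).toReal - 1) ∂μ₀

/-- `∑_{S ⊆ [k], |S| ≥ 2} n^{-|S|/2} ρ^{-|S|} |𝔼_{A ∼ μ₀} ∏_{i ∈ S} (μ_i(A)/μ₀(A) - 1)| ≤ 1/n`. -/
def ApproxUncorrelated {Ω : Type*} [MeasurableSpace Ω] {k : ℕ}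
    (ρ : ℝ) (μ₀ : Measure Ω) (μ : Fin k → Measure Ω) (n : ℕ) : Prop :=
  ∑ S : Finset (Fin k) with 2 ≤ S.card,
    (n : ℝ) ^ (-(S.card : ℝ) / 2) * ρ ^ (-(S.card : ℝ)) * |highOrderCorr μ₀ μ S| ≤ 1 / (n : ℝ)

/-- An algorithm with `s` bits of memory processing a stream of points of `Ω` and producing an
index in `[k]`: an initial memory, an arbitrary (measurable) update function `f_j` for each time
step `j`, and an output that is a function of the final memory. -/
structure StreamAlg (Ω : Type*) [MeasurableSpace Ω] (s k : ℕ) where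
  init : Fin s → Bool
  step : ℕ → Ω → (Fin s → Bool) → (Fin s → Bool)
  measurable_step : ∀ j u, Measurable fun x => step j x u
  output : (Fin s → Bool) → Fin k

namespace StreamAlg

variable {Ω : Type*} [MeasurableSpace Ω] {s k : ℕ}

/-- The memory after the first `j` elements of a stream `y 0, y 1, …`. -/
def memory (A : StreamAlg Ω s k) (y : ℕ → Ω) : ℕ → (Fin s → Bool)
  | 0 => A.init
  | j + 1 => A.step j (y j) (A.memory y j)

/-- The output after `ℓ` passes, each going in order over the `t` data points `x`: the `j`-th
element of the stream (counting from `0`) is the data point with index `j % t`. -/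
def run (A : StreamAlg Ω s k) {t : ℕ} (ht : 1 ≤ t) (ℓ : ℕ) (x : Fin t → Ω) : Fin k :=
  A.output (A.memory (fun j => x ⟨j % t, Nat.mod_lt j ht⟩) (t * ℓ))

/-- `A`, making `ℓ` passes over `t` i.i.d. samples, identifies `μ₁, …, μ_k` with error `ε`:
for every `i`, if the samples come from `μ_i` then the output is `i` with probability at least
`1 - ε`. -/
def Identifies (A : StreamAlg Ω s k) {t : ℕ} (ht : 1 ≤ t) (ℓ : ℕ)
    (μ : Fin k → Measure Ω) (ε : ℝ) : Prop :=
  ∀ i, 1 - ε ≤ (Measure.pi fun _ : Fin t => μ i).real {x | A.run ht ℓ x = i}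

end StreamAlg

/-! ### Elementary inequalities -/

/-! Write `μ i` as `μ₀` with density `1 + ρ * g i`, where `|g i| ≤ 1` and `g i` has mean zero, and
put ε = ρ√n; the hypotheses make ε² log k small. Cut the t samples into N ≈ t/n blocks of n samples.
The transcript consists of the memories at the ends of the ℓN block visits; as in a communication
protocol, its fibers are products over the blocks. Let P be the law of a block under `μ₀` and L_i
the likelihood ratio of a block under `μ i`.

Identification forces the relative entropies of the transcript, from `μ₀` to `μ i`, to sum over i to
at least k/100 (`le_sum_mul_log_div`). On a fiber, the log ratio is a sum over blocks of -log r,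
where r is the mean of L_i under P conditioned on the factor of that block. Changing the law of a
single block keeps the total mass of the fibers equal to 1 (`sum_hybrid`), so r - 1 averages to 0
and -log r may be replaced by r - 1 - log r, which is of second order.

The core is the one-block estimate `sum_sub_one_sub_log_le`: conditioning P on a set of probability
p gives Σ_i (r_i - 1 - log r_i) ≲ ε² log k (log(1/p) + 1), up to a tail of small mean. By the
variational principle (`integral_le_of_exp_le`) it rests on an exponential moment under P of a sum
over i of truncated deviations of L_i. Each exponential is majorized by a multiaffine function of
the values g_i(x_j). The mean of the product of these functions factors over the n coordinates
(`integral_prod_multiaffine_le`) and is controlled by the n-th power of the correlation sum, at most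
(1 + 1/n)^n ≤ e.

Summed over the blocks, log(1/p) becomes the log of the inverse probability of the transcript. Its
average is an entropy, at most sℓN log 2. Hence k ≲ ε² log k · sℓN, and Nn ≤ 2t finishes. -/

theorem Real.exp_le_one_add_add_sq_mul_exp (x : ℝ) :
    Real.exp x ≤ 1 + x + x ^ 2 * Real.exp (max x 0) := by
  rcases le_total x 0 with hx | hx
  · rw [max_eq_right hx, Real.exp_zero, mul_one]
    have h1 : Real.exp x * (1 - x) ≤ 1 := by
      have := Real.add_one_le_exp (-x)
      calc Real.exp x * (1 - x) ≤ Real.exp x * Real.exp (-x) := by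
            gcongr; linarith
        _ = 1 := by rw [← Real.exp_add]; simp
    have h2 : (1 : ℝ) ≤ (1 + x + x ^ 2) * (1 - x) := by
      nlinarith [mul_nonneg (sq_nonneg x) (neg_nonneg.2 hx)]
    exact le_of_mul_le_mul_right (h1.trans h2) (by linarith)
  · rw [max_eq_left hx]
    have h1 : (1 - x) * Real.exp x ≤ 1 := by
      have := Real.add_one_le_exp (-x)
      calc (1 - x) * Real.exp x ≤ Real.exp (-x) * Real.exp x := by
            gcongr; linarith
        _ = 1 := by rw [← Real.exp_add]; simp
    have h2 : 1 ≤ Real.exp x := Real.one_le_exp hx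
    nlinarith

theorem Real.sq_le_mul_exp_div_eight {w : ℝ} (hw : 0 ≤ w) :
    w ^ 2 ≤ 128 * Real.exp (w / 8) := by
  have := Real.quadratic_le_exp_of_nonneg (x := w / 8) (by positivity)
  nlinarith

theorem Real.exp_half_le_two : Real.exp (1 / 2) ≤ 2 := by
  have := Real.exp_bound_div_one_sub_of_interval (x := 1 / 2) (by norm_num) (by norm_num)
  norm_num at this ⊢; exact this

/-- Second-order bound for the moment generating function of a truncated likelihood ratio. -/
theorem exp_mul_min_sub_one_le {L w ε l : ℝ} (hL : 0 < L) (hε : 0 < ε)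
    (hl : 0 ≤ l) (hl' : l ≤ 1 / 16) (hw : 0 ≤ w) (hy : |Real.log L| ≤ ε * w) :
    Real.exp (l / ε * min (L - 1) 1) ≤ 1 + l / ε * (L - 1) + 512 * l ^ 2 * Real.exp (w / 2) := by
  have hm : |min (L - 1) 1| ≤ 2 * (ε * w) := by
    have hlog := Real.one_sub_inv_le_log_of_pos hL
    have hy1 := neg_abs_le (Real.log L)
    have hy2 := le_abs_self (Real.log L)
    have h0 : 0 ≤ ε * w := by positivity
    rw [abs_le]
    constructor
    · rw [le_min_iff]
      constructor
      · have := Real.log_le_sub_one_of_pos hL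
        linarith
      · linarith
    · rcases le_total L 1 with h1 | h1
      · exact (min_le_left _ _).trans (by linarith)
      · rcases le_total L 2 with h2 | h2
        · refine (min_le_left _ _).trans ?_
          have : (L - 1) / L ≤ ε * w := by
            calc (L - 1) / L = 1 - L⁻¹ := by field_simp
              _ ≤ _ := by linarith
          rw [div_le_iff₀ hL] at this
          nlinarith
        · refine (min_le_right _ _).trans ?_
          have : L⁻¹ ≤ 2⁻¹ := inv_anti₀ (by norm_num) h2
          linarith
  set x := l / ε * min (L - 1) 1 with hx
  have hxa : |x| ≤ 2 * l * w := by
    rw [hx, abs_mul, abs_of_nonneg (by positivity : 0 ≤ l / ε)]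
    calc l / ε * |min (L - 1) 1| ≤ l / ε * (2 * (ε * w)) := by gcongr
      _ = 2 * l * w := by field_simp
  have h1 := Real.exp_le_one_add_add_sq_mul_exp x
  -- Truncating at 1 makes the exponent linear in `w`; without it, `L - 1` could grow like `exp (ε *
  -- w)`.
  have h2 : max x 0 ≤ w / 8 := by
    refine max_le ?_ (by positivity)
    have := le_abs_self x
    nlinarith
  have h3 : x ^ 2 ≤ 4 * l ^ 2 * w ^ 2 := by
    rw [← sq_abs]
    calc |x| ^ 2 ≤ (2 * l * w) ^ 2 := by gcongr
      _ = _ := by ring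
  have h4 : x ^ 2 * Real.exp (max x 0) ≤ 512 * l ^ 2 * Real.exp (w / 2) := by
    calc x ^ 2 * Real.exp (max x 0) ≤ (4 * l ^ 2 * w ^ 2) * Real.exp (w / 8) := by gcongr
      _ ≤ (4 * l ^ 2 * (128 * Real.exp (w / 8))) * Real.exp (w / 8) := by
          gcongr; exact Real.sq_le_mul_exp_div_eight hw
      _ = 512 * l ^ 2 * Real.exp (w / 8 + w / 8) := by rw [Real.exp_add]; ring
      _ ≤ 512 * l ^ 2 * Real.exp (w / 2) := by gcongr; linarith
  have h5 : x ≤ l / ε * (L - 1) := by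
    rw [hx]; gcongr; exact min_le_left _ _
  linarith

/-- No truncation is needed in this direction: `1 - L ≤ ε * w` already keeps the exponent below `w /
16`. Large values of `L` enter only through the square of the exponent, where `ε ≤ 1 / 16` makes the
extra factor `exp (2 * ε * w)` affordable. -/
theorem exp_neg_mul_sub_one_le {L w ε l : ℝ} (hL : 0 < L) (hε : 0 < ε) (hε' : ε ≤ 1 / 16)
    (hl : 0 ≤ l) (hl' : l ≤ 1 / 16) (hw : 0 ≤ w) (hy : |Real.log L| ≤ ε * w) :
    Real.exp (-(l / ε * (L - 1))) ≤
      1 - l / ε * (L - 1) + 512 * l ^ 2 * Real.exp (w / 2) := by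
  have hlow : -(ε * w) ≤ L - 1 := by
    have := Real.log_le_sub_one_of_pos hL
    have := neg_abs_le (Real.log L)
    linarith
  have hLw : L ≤ Real.exp (ε * w) := by
    rw [← Real.log_le_iff_le_exp hL]
    exact (le_abs_self _).trans hy
  have hm : |L - 1| ≤ ε * w * Real.exp (ε * w) := by
    have h0 : 0 ≤ ε * w := by positivity
    have he := Real.one_le_exp h0
    rw [abs_le]
    constructor
    · nlinarith
    · have hlog := Real.one_sub_inv_le_log_of_pos hL
      have hy2 := le_abs_self (Real.log L)
      have : (L - 1) / L ≤ ε * w := by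
        calc (L - 1) / L = 1 - L⁻¹ := by field_simp
          _ ≤ _ := by linarith
      rw [div_le_iff₀ hL] at this
      exact this.trans (by gcongr)
  set x := -(l / ε * (L - 1)) with hx
  have hxa : |x| ≤ l * w * Real.exp (ε * w) := by
    rw [hx, abs_neg, abs_mul, abs_of_nonneg (by positivity : 0 ≤ l / ε)]
    calc l / ε * |L - 1| ≤ l / ε * (ε * w * Real.exp (ε * w)) := by gcongr
      _ = _ := by field_simp
  have h1 := Real.exp_le_one_add_add_sq_mul_exp x
  have h2 : max x 0 ≤ w / 16 := by
    refine max_le ?_ (by positivity)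
    calc x = l / ε * (-(L - 1)) := by rw [hx]; ring
      _ ≤ l / ε * (ε * w) := by gcongr; linarith
      _ = l * w := by field_simp
      _ ≤ w / 16 := by nlinarith
  have h3 : x ^ 2 ≤ l ^ 2 * w ^ 2 * Real.exp (w / 8) := by
    rw [← sq_abs]
    calc |x| ^ 2 ≤ (l * w * Real.exp (ε * w)) ^ 2 := by gcongr
      _ = l ^ 2 * w ^ 2 * Real.exp (ε * w + ε * w) := by rw [Real.exp_add]; ring
      _ ≤ _ := by gcongr; nlinarith
  have h4 : x ^ 2 * Real.exp (max x 0) ≤ 512 * l ^ 2 * Real.exp (w / 2) := by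
    calc x ^ 2 * Real.exp (max x 0) ≤ (l ^ 2 * w ^ 2 * Real.exp (w / 8)) * Real.exp (w / 16) := by
          gcongr
      _ ≤ (l ^ 2 * (128 * Real.exp (w / 8)) * Real.exp (w / 8)) * Real.exp (w / 16) := by
          gcongr; exact Real.sq_le_mul_exp_div_eight hw
      _ = 128 * l ^ 2 * Real.exp (w / 8 + w / 8 + w / 16) := by
          rw [Real.exp_add, Real.exp_add]; ring
      _ ≤ 512 * l ^ 2 * Real.exp (w / 2) := by gcongr <;> linarith
  linarith

/-! ### Likelihood ratios of product measures -/

/-- The likelihood ratio `∏ j, (1 + θ g(x_j))`. -/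
noncomputable def likelihood {Ω : Type*} (g : Ω → ℝ) (θ : ℝ) {n : ℕ} (x : Fin n → Ω) : ℝ :=
  ∏ j, (1 + θ * g (x j))

/-- The normalized score `n^{-1/2} ∑ j, g(x_j)`. -/
noncomputable def score {Ω : Type*} (g : Ω → ℝ) {n : ℕ} (x : Fin n → Ω) : ℝ :=
  (∑ j, g (x j)) / √n

theorem Real.sub_two_mul_sq_le_log_one_add {x : ℝ} (hx : -(1 / 2) ≤ x) :
    x - 2 * x ^ 2 ≤ Real.log (1 + x) := by
  have h1 : (0 : ℝ) < 1 + x := by linarith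
  refine le_trans ?_ (Real.one_sub_inv_le_log_of_pos h1)
  rw [← sub_nonneg]
  have : 1 - (1 + x)⁻¹ - (x - 2 * x ^ 2) = x ^ 2 * (1 + 2 * x) / (1 + x) := by field_simp; ring
  rw [this]
  have : 0 ≤ 1 + 2 * x := by linarith
  positivity

section Likelihood

variable {Ω : Type*} {g : Ω → ℝ} {θ : ℝ} {n : ℕ}

theorem one_add_mul_pos (hg : ∀ a, |g a| ≤ 1) (hθ : |θ| ≤ 1 / 2) (a : Ω) : 0 < 1 + θ * g a := by
  have : |θ * g a| ≤ 1 / 2 := by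
    rw [abs_mul]
    calc |θ| * |g a| ≤ 1 / 2 * 1 := mul_le_mul hθ (hg a) (abs_nonneg _) (by norm_num)
      _ = 1 / 2 := by norm_num
  have := (abs_le.1 this).1
  linarith

theorem likelihood_pos (hg : ∀ a, |g a| ≤ 1) (hθ : |θ| ≤ 1 / 2) (x : Fin n → Ω) :
    0 < likelihood g θ x :=
  Finset.prod_pos fun j _ => one_add_mul_pos hg hθ (x j)

theorem log_likelihood_le (hg : ∀ a, |g a| ≤ 1) (hθ : |θ| ≤ 1 / 2) (x : Fin n → Ω) :
    Real.log (likelihood g θ x) ≤ θ * ∑ j, g (x j) := by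
  rw [likelihood, Real.log_prod (fun j _ => (one_add_mul_pos hg hθ (x j)).ne'), Finset.mul_sum]
  refine Finset.sum_le_sum fun j _ => ?_
  have := Real.log_le_sub_one_of_pos (one_add_mul_pos hg hθ (x j))
  linarith

theorem le_log_likelihood (hg : ∀ a, |g a| ≤ 1) (hθ : |θ| ≤ 1 / 2) (x : Fin n → Ω) :
    θ * ∑ j, g (x j) - 2 * θ ^ 2 * n ≤ Real.log (likelihood g θ x) := by
  rw [likelihood, Real.log_prod (fun j _ => (one_add_mul_pos hg hθ (x j)).ne'), Finset.mul_sum]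
  have : 2 * θ ^ 2 * n = ∑ _j : Fin n, 2 * θ ^ 2 := by simp [mul_comm]
  rw [this, ← Finset.sum_sub_distrib]
  refine Finset.sum_le_sum fun j _ => ?_
  have h1 : |θ * g (x j)| ≤ |θ| := by
    rw [abs_mul]
    exact mul_le_of_le_one_right (abs_nonneg _) (hg _)
  have h2 := Real.sub_two_mul_sq_le_log_one_add (x := θ * g (x j)) (by
    have := (abs_le.1 (h1.trans hθ)).1; linarith)
  have h3 : (θ * g (x j)) ^ 2 ≤ θ ^ 2 := sq_le_sq.2 h1
  linarith

theorem mul_sqrt_mul_score (hn : 1 ≤ n) (x : Fin n → Ω) (θ : ℝ) :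
    θ * √n * score g x = θ * ∑ j, g (x j) := by
  have : (0 : ℝ) < √n := Real.sqrt_pos.2 (by exact_mod_cast hn)
  rw [score]; field_simp

/-- The log-likelihood is linear in the score up to an error 2(θ√n)², which is at most θ√n and is
absorbed by the `+ 1`. -/
theorem abs_log_likelihood_le (hn : 1 ≤ n) (hg : ∀ a, |g a| ≤ 1) (hθ0 : 0 ≤ θ)
    (hθ : θ * √n ≤ 1 / 2) (x : Fin n → Ω) :
    |Real.log (likelihood g θ x)| ≤ θ * √n * (|score g x| + 1) := by
  have h1n : (1 : ℝ) ≤ √n := by rw [Real.one_le_sqrt]; exact_mod_cast hn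
  have hθ' : |θ| ≤ 1 / 2 := by rw [abs_of_nonneg hθ0]; nlinarith
  have hu := log_likelihood_le hg hθ' x
  have hl := le_log_likelihood hg hθ' x
  rw [← mul_sqrt_mul_score hn] at hu hl
  have hsq : 2 * θ ^ 2 * n = 2 * (θ * √n) ^ 2 := by
    rw [mul_pow, Real.sq_sqrt (by positivity)]; ring
  rw [hsq] at hl
  have h0 : 0 ≤ θ * √n := by positivity
  have ha := mul_le_mul_of_nonneg_left (le_abs_self (score g x)) h0
  have hb := mul_le_mul_of_nonneg_left (neg_abs_le (score g x)) h0
  rw [abs_le]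
  constructor <;> nlinarith

/-- Replaces an exponential of the score by likelihood ratios, which are multiaffine in the values
of `g`, so that the mixed-moment bound applies. At θ = ±1/(2√n) the quadratic loss 2θ²n is exactly
1/2, which costs at most a factor 2. -/
theorem exp_abs_score_le (hn : 1 ≤ n) (hg : ∀ a, |g a| ≤ 1) (x : Fin n → Ω) :
    Real.exp (|score g x| / 2) ≤
      2 * (likelihood g (1 / (2 * √n)) x + likelihood g (-(1 / (2 * √n))) x) := by
  have h1n : (1 : ℝ) ≤ √n := by rw [Real.one_le_sqrt]; exact_mod_cast hn
  have hpos : (0 : ℝ) < √n := by linarith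
  have h0 : |1 / (2 * √(n : ℝ))| ≤ 1 / 2 := by
    rw [abs_of_nonneg (by positivity)]
    exact one_div_le_one_div_of_le (by norm_num) (by linarith)
  have h0' : |-(1 / (2 * √(n : ℝ)))| ≤ 1 / 2 := by rwa [abs_neg]
  have key : ∀ θ : ℝ, |θ| ≤ 1 / 2 → 2 * θ ^ 2 * n = 1 / 2 →
      Real.exp (θ * √n * score g x) ≤ 2 * likelihood g θ x := by
    intro θ hθ hθ2
    have := le_log_likelihood hg hθ x
    rw [Real.le_log_iff_exp_le (likelihood_pos hg hθ x), hθ2, ← mul_sqrt_mul_score hn,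
      sub_eq_add_neg, Real.exp_add] at this
    have h4 : (1 : ℝ) / 2 ≤ Real.exp (-(1 / 2)) := by
      have := Real.add_one_le_exp (-(1 / 2 : ℝ)); linarith
    have h5 := Real.exp_pos (θ * √n * score g x)
    nlinarith
  have hsq : (√(n : ℝ)) ^ 2 = n := Real.sq_sqrt (by positivity)
  have e1 := key _ h0 (by
    rw [div_pow, mul_pow, hsq]; have : (n : ℝ) ≠ 0 := by positivity
    field_simp)
  have e2 := key _ h0' (by
    rw [neg_sq, div_pow, mul_pow, hsq]; have : (n : ℝ) ≠ 0 := by positivity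
    field_simp)
  have p1 := likelihood_pos hg h0 x
  have p2 := likelihood_pos hg h0' x
  rcases le_total 0 (score g x) with h | h
  · rw [abs_of_nonneg h]
    have : 1 / (2 * √(n : ℝ)) * √n * score g x = score g x / 2 := by field_simp
    rw [this] at e1; linarith
  · rw [abs_of_nonpos h]
    have : -(1 / (2 * √(n : ℝ))) * √n * score g x = -score g x / 2 := by field_simp
    rw [this] at e2; linarith

theorem abs_score_le (hg1 : ∀ a, |g a| ≤ 1) (x : Fin n → Ω) : |score g x| ≤ n := by
  rw [score, abs_div, abs_of_nonneg (Real.sqrt_nonneg _)]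
  rcases Nat.eq_zero_or_pos n with rfl | hn
  · simp
  have h1n : (1 : ℝ) ≤ √n := by rw [Real.one_le_sqrt]; exact_mod_cast hn
  refine (div_le_self (abs_nonneg _) h1n).trans ?_
  calc |∑ j, g (x j)| ≤ ∑ j, |g (x j)| := Finset.abs_sum_le_sum_abs _ _
    _ ≤ ∑ _j : Fin n, (1 : ℝ) := Finset.sum_le_sum fun j _ => hg1 _
    _ = n := by simp

theorem abs_likelihood_le (hg1 : ∀ a, |g a| ≤ 1) (θ : ℝ) (x : Fin n → Ω) :
    |likelihood g θ x| ≤ (1 + |θ|) ^ n := by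
  rw [likelihood, Finset.abs_prod]
  calc ∏ j, |1 + θ * g (x j)| ≤ ∏ _j : Fin n, (1 + |θ|) := by
        refine Finset.prod_le_prod (fun _ _ => abs_nonneg _) fun j _ => ?_
        refine (abs_add_le _ _).trans ?_
        rw [abs_one, abs_mul]
        gcongr
        exact mul_le_of_le_one_right (abs_nonneg _) (hg1 _)
    _ = _ := by simp

end Likelihood

/-! ### Densities of a centered family -/

theorem IsCenteredFamily.exists_density {Ω : Type*} [MeasurableSpace Ω] {k : ℕ} {ρ : ℝ}
    {μ₀ : Measure Ω} {μ : Fin k → Measure Ω} (h : IsCenteredFamily ρ μ₀ μ) :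
    ∃ g : Fin k → Ω → ℝ, (∀ i, Measurable (g i)) ∧ (∀ i a, |g i a| ≤ 1) ∧
      (∀ i, μ i = μ₀.withDensity fun a => ENNReal.ofReal (1 + ρ * g i a)) ∧
      ∀ S, highOrderCorr μ₀ μ S = ρ ^ S.card * ∫ a, ∏ i ∈ S, g i a ∂μ₀ := by
  have := h.prob_center
  have := h.prob
  have hρ := h.rho_pos
  have hac : ∀ i, μ i ≪ μ₀ := by
    intro i
    refine Measure.AbsolutelyContinuous.mk fun s hs h0 => ?_
    have h1 := h.upper i s hs
    rw [measureReal_def, measureReal_def, h0] at h1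
    simp only [ENNReal.toReal_zero, mul_zero] at h1
    have h2 := le_antisymm h1 ENNReal.toReal_nonneg
    exact (ENNReal.toReal_eq_zero_iff _).1 h2 |>.resolve_right (measure_ne_top _ _)
  have hlow : ∀ i, ∀ᵐ a ∂μ₀, 1 - ρ ≤ ((μ i).rnDeriv μ₀ a).toReal := by
    intro i
    refine ae_le_of_forall_setIntegral_le (integrable_const _) Measure.integrable_toReal_rnDeriv ?_
    intro s hs _
    rw [Measure.setIntegral_toReal_rnDeriv (hac i), setIntegral_const, smul_eq_mul, mul_comm]
    exact h.lower i s hs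
  have hup : ∀ i, ∀ᵐ a ∂μ₀, ((μ i).rnDeriv μ₀ a).toReal ≤ 1 + ρ := by
    intro i
    refine ae_le_of_forall_setIntegral_le Measure.integrable_toReal_rnDeriv (integrable_const _) ?_
    intro s hs _
    rw [Measure.setIntegral_toReal_rnDeriv (hac i), setIntegral_const, smul_eq_mul, mul_comm]
    exact h.upper i s hs
  -- The density bounds hold only almost everywhere; clamping gives a version bounded by 1 at every
  -- point.
  let g : Fin k → Ω → ℝ := fun i a => max (-1) (min 1 ((((μ i).rnDeriv μ₀ a).toReal - 1) / ρ))
  have hg : ∀ i, ∀ᵐ a ∂μ₀, ((μ i).rnDeriv μ₀ a).toReal - 1 = ρ * g i a := by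
    intro i
    filter_upwards [hlow i, hup i] with a h1 h2
    have h3 : (((μ i).rnDeriv μ₀ a).toReal - 1) / ρ ≤ 1 := by
      rw [div_le_one hρ]; linarith
    have h4 : -1 ≤ (((μ i).rnDeriv μ₀ a).toReal - 1) / ρ := by
      rw [le_div_iff₀ hρ]; linarith
    simp only [g]
    rw [min_eq_right h3, max_eq_right h4]
    field_simp
  refine ⟨g, ?_, ?_, ?_, ?_⟩
  · intro i
    have := Measure.measurable_rnDeriv (μ i) μ₀
    fun_prop
  · intro i a
    rw [abs_le]
    exact ⟨le_max_left _ _, max_le (by norm_num) (min_le_left _ _)⟩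
  · intro i
    conv_lhs => rw [← Measure.withDensity_rnDeriv_eq (μ i) μ₀ (hac i)]
    refine withDensity_congr_ae ?_
    filter_upwards [hg i, Measure.rnDeriv_lt_top (μ i) μ₀] with a h1 h2
    rw [← h1, add_sub_cancel, ENNReal.ofReal_toReal h2.ne]
  · intro S
    rw [highOrderCorr, ← integral_const_mul]
    refine integral_congr_ae ?_
    filter_upwards [ae_all_iff.2 hg] with a ha
    simp_rw [ha, Finset.prod_mul_distrib, Finset.prod_const]

/-! ### Product measures -/

section Prod

variable {Ω : Type*} [MeasurableSpace Ω] {g : Ω → ℝ} {θ : ℝ} {n : ℕ}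

theorem measurable_likelihood (hg : Measurable g) (θ : ℝ) :
    Measurable (likelihood g θ : (Fin n → Ω) → ℝ) := by
  unfold likelihood
  fun_prop

theorem measurable_score (hg : Measurable g) : Measurable (score g : (Fin n → Ω) → ℝ) := by
  unfold score
  fun_prop

theorem integrable_likelihood (hg : Measurable g) (hg1 : ∀ a, |g a| ≤ 1) (θ : ℝ)
    (Q : Measure (Fin n → Ω)) [IsFiniteMeasure Q] : Integrable (likelihood g θ) Q :=
  Integrable.of_bound (measurable_likelihood hg θ).aestronglyMeasurable _
    (Filter.Eventually.of_forall fun x => abs_likelihood_le hg1 θ x)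

theorem pi_withDensity_likelihood (μ₀ : Measure Ω) [IsProbabilityMeasure μ₀]
    (hg : Measurable g) (hg1 : ∀ a, |g a| ≤ 1) (hθ : |θ| ≤ 1 / 2)
    [IsProbabilityMeasure (μ₀.withDensity fun a => ENNReal.ofReal (1 + θ * g a))] :
    (Measure.pi fun _ : Fin n => μ₀.withDensity fun a => ENNReal.ofReal (1 + θ * g a)) =
      (Measure.pi fun _ : Fin n => μ₀).withDensity fun x =>
        ENNReal.ofReal (likelihood g θ x) := by
  have hint : Integrable (fun a => 1 + θ * g a) μ₀ :=
    (integrable_const _).add ((Integrable.of_bound hg.aestronglyMeasurable 1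
      (Filter.Eventually.of_forall hg1)).const_mul _)
  refine Measure.pi_eq fun s hs => ?_
  have hbox : MeasurableSet (Set.univ.pi s) := MeasurableSet.univ_pi hs
  rw [withDensity_apply _ hbox, ← ofReal_integral_eq_lintegral_ofReal
    (integrable_likelihood hg hg1 θ _)
    (Filter.Eventually.of_forall fun x => (likelihood_pos hg1 hθ x).le)]
  have h1 : ∀ j, (μ₀.withDensity fun a => ENNReal.ofReal (1 + θ * g a)) (s j) =
      ENNReal.ofReal (∫ a, (s j).indicator (fun a => 1 + θ * g a) a ∂μ₀) := by
    intro j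
    rw [withDensity_apply _ (hs j), ← ofReal_integral_eq_lintegral_ofReal hint.integrableOn
      (Filter.Eventually.of_forall fun a => (one_add_mul_pos hg1 hθ a).le),
      integral_indicator (hs j)]
  simp_rw [h1]
  rw [← ENNReal.ofReal_prod_of_nonneg]
  · congr 1
    rw [← integral_fintype_prod_eq_prod, ← integral_indicator hbox]
    refine integral_congr_ae (Filter.Eventually.of_forall fun x => ?_)
    by_cases hx : x ∈ Set.univ.pi s
    · rw [Set.indicator_of_mem hx]
      refine Finset.prod_congr rfl fun j _ => ?_
      rw [Set.indicator_of_mem (hx j trivial)]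
    · rw [Set.indicator_of_notMem hx]
      simp only [Set.mem_pi, Set.mem_univ, true_implies, not_forall] at hx
      obtain ⟨j, hj⟩ := hx
      exact (Finset.prod_eq_zero (Finset.mem_univ j) (Set.indicator_of_notMem hj _)).symm
  · intro j _
    exact integral_nonneg fun a => Set.indicator_nonneg (fun a _ => (one_add_mul_pos hg1 hθ a).le) a

/-- Hoeffding's lemma in each coordinate, at the parameter α/√n. -/
theorem integral_exp_mul_score_le (μ₀ : Measure Ω) [IsProbabilityMeasure μ₀] (hn : 1 ≤ n)
    (hg : Measurable g) (hg1 : ∀ a, |g a| ≤ 1) (h0 : ∫ a, g a ∂μ₀ = 0) (α : ℝ) :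
    ∫ x, Real.exp (α * score g x) ∂(Measure.pi fun _ : Fin n => μ₀) ≤ Real.exp (α ^ 2 / 2) := by
  have hn0 : (0 : ℝ) < n := by exact_mod_cast hn
  have h1 : ∀ x : Fin n → Ω, Real.exp (α * score g x) = ∏ j, Real.exp (α / √n * g (x j)) := by
    intro x
    rw [← Real.exp_sum, ← Finset.mul_sum, score]
    congr 1; ring
  simp_rw [h1]
  rw [integral_fintype_prod_eq_pow (fun a => Real.exp (α / √n * g a)), Fintype.card_fin]
  have h2 := (ProbabilityTheory.hasSubgaussianMGF_of_mem_Icc_of_integral_eq_zero (μ := μ₀)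
    (a := -1) (b := 1) hg.aemeasurable
    (Filter.Eventually.of_forall fun a => abs_le.1 (hg1 a)) h0).mgf_le (α / √n)
  rw [ProbabilityTheory.mgf] at h2
  have h3 : ((‖(1 : ℝ) - -1‖₊ / 2) ^ 2 : NNReal) = 1 := by
    rw [show (1 : ℝ) - -1 = 2 by norm_num]
    ext; simp
  rw [h3] at h2
  calc (∫ a, Real.exp (α / √n * g a) ∂μ₀) ^ n
      ≤ (Real.exp (((1 : NNReal) : ℝ) * (α / √n) ^ 2 / 2)) ^ n := by
        gcongr
    _ = Real.exp (α ^ 2 / 2) := by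
        rw [← Real.exp_nat_mul]
        congr 1
        rw [div_pow, Real.sq_sqrt hn0.le]
        push_cast; field_simp

theorem integrable_exp_mul_abs_score (hg : Measurable g) (hg1 : ∀ a, |g a| ≤ 1) (α : ℝ)
    (Q : Measure (Fin n → Ω)) [IsFiniteMeasure Q] :
    Integrable (fun x => Real.exp (α * |score g x|)) Q := by
  refine Integrable.of_bound (C := Real.exp (|α| * n)) ?_ (Filter.Eventually.of_forall fun x => ?_)
  · have := measurable_score (n := n) hg
    exact (by fun_prop : Measurable fun x => Real.exp (α * |score g x|)).aestronglyMeasurable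
  · rw [Real.norm_eq_abs, Real.abs_exp]
    gcongr
    · exact le_abs_self _
    · exact abs_score_le hg1 x

theorem integral_exp_mul_abs_score_le (μ₀ : Measure Ω) [IsProbabilityMeasure μ₀] (hn : 1 ≤ n)
    (hg : Measurable g) (hg1 : ∀ a, |g a| ≤ 1) (h0 : ∫ a, g a ∂μ₀ = 0) (α : ℝ) :
    ∫ x, Real.exp (α * |score g x|) ∂(Measure.pi fun _ : Fin n => μ₀) ≤
      2 * Real.exp (α ^ 2 / 2) := by
  have hi : ∀ β : ℝ, Integrable (fun x => Real.exp (β * score g x))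
      (Measure.pi fun _ : Fin n => μ₀) := by
    intro β
    refine Integrable.of_bound (C := Real.exp (|β| * n)) ?_
      (Filter.Eventually.of_forall fun x => ?_)
    · have := measurable_score (n := n) hg
      exact (by fun_prop : Measurable fun x => Real.exp (β * score g x)).aestronglyMeasurable
    · rw [Real.norm_eq_abs, Real.abs_exp]
      refine Real.exp_le_exp.2 ((le_abs_self _).trans ?_)
      rw [abs_mul]
      gcongr
      exact abs_score_le hg1 x
  have h1 := integral_exp_mul_score_le μ₀ hn hg hg1 h0 α
  have h2 := integral_exp_mul_score_le μ₀ hn hg hg1 h0 (-α)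
  rw [neg_sq] at h2
  calc _ ≤ ∫ x, (Real.exp (α * score g x) + Real.exp (-α * score g x))
        ∂(Measure.pi fun _ : Fin n => μ₀) := by
        refine integral_mono (integrable_exp_mul_abs_score hg hg1 α _) ((hi α).add (hi (-α))) ?_
        intro x
        simp only
        have p1 := Real.exp_pos (α * score g x)
        have p2 := Real.exp_pos (-α * score g x)
        rcases abs_choice (score g x) with h | h <;> rw [h]
        · linarith
        · rw [mul_neg, ← neg_mul]; linarith
    _ = _ := integral_add (hi α) (hi (-α))
    _ ≤ _ := by linarith

end Prod

/-! ### Mixed moments of multiaffine statistics -/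

/-- Transposition of a relation given by its rows. -/
def finsetTranspose (α β : Type*) [Fintype α] [Fintype β] [DecidableEq α] [DecidableEq β] :
    (α → Finset β) ≃ (β → Finset α) where
  toFun p b := Finset.univ.filter fun a => b ∈ p a
  invFun q a := Finset.univ.filter fun b => a ∈ q b
  left_inv p := by ext a b; simp
  right_inv q := by ext b a; simp

theorem prod_prod_mem_transpose {α β M : Type*} [Fintype α] [Fintype β] [DecidableEq α]
    [DecidableEq β] [CommMonoid M] (p : α → Finset β) (f : α → β → M) :
    ∏ a, ∏ b ∈ p a, f a b = ∏ b, ∏ a ∈ finsetTranspose α β p b, f a b := by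
  have h1 : ∀ a, ∏ b ∈ p a, f a b = ∏ b, if b ∈ p a then f a b else 1 := by
    intro a; rw [Finset.prod_ite_mem, Finset.univ_inter]
  simp_rw [h1]
  rw [Finset.prod_comm]
  refine Finset.prod_congr rfl fun b _ => ?_
  simp [finsetTranspose, Finset.prod_filter]

/-- Expanding the product chooses a set J_i of coordinates for each i. Transposing, this is a set
S_j of indices for each coordinate j, with Σ|J_i| = Σ|S_j|. Independence of the coordinates turns
each monomial into a product over j of mixed moments, and the sum over all choices of the S_j is
then an n-th power. -/
theorem integral_prod_multiaffine_le {Ω : Type*} [MeasurableSpace Ω] {k n : ℕ}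
    (μ₀ : Measure Ω) [IsProbabilityMeasure μ₀] {g : Fin k → Ω → ℝ}
    (hg : ∀ i, Measurable (g i)) (hg1 : ∀ i a, |g i a| ≤ 1) {a : ℝ}
    {A : Fin k → Finset (Fin n) → ℝ} {b : Fin k → ℝ}
    (hA : ∀ i J, |A i J| ≤ b i * a ^ J.card) :
    ∫ x, ∏ i, ∑ J, A i J * ∏ j ∈ J, g i (x j) ∂(Measure.pi fun _ : Fin n => μ₀) ≤
      (∏ i, b i) * (∑ S : Finset (Fin k), a ^ S.card * |∫ y, ∏ i ∈ S, g i y ∂μ₀|) ^ n := by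
  set c : Finset (Fin k) → ℝ := fun S => ∫ y, ∏ i ∈ S, g i y ∂μ₀ with hc
  have hexp : ∀ x : Fin n → Ω, ∏ i, ∑ J, A i J * ∏ j ∈ J, g i (x j) =
      ∑ p : Fin k → Finset (Fin n), (∏ i, A i (p i)) *
        ∏ j, ∏ i ∈ finsetTranspose _ _ p j, g i (x j) := by
    intro x
    rw [Finset.prod_univ_sum, Fintype.piFinset_univ]
    refine Finset.sum_congr rfl fun p _ => ?_
    rw [Finset.prod_mul_distrib, prod_prod_mem_transpose]
  simp_rw [hexp]
  have hint : ∀ p : Fin k → Finset (Fin n), Integrable (fun x : Fin n → Ω => (∏ i, A i (p i)) *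
        ∏ j, ∏ i ∈ finsetTranspose _ _ p j, g i (x j)) (Measure.pi fun _ : Fin n => μ₀) := by
    intro p
    refine Integrable.const_mul ?_ _
    refine Integrable.of_bound (C := 1) ?_ (Filter.Eventually.of_forall fun x => ?_)
    · exact (by fun_prop : Measurable fun x : Fin n → Ω =>
        ∏ j, ∏ i ∈ finsetTranspose _ _ p j, g i (x j)).aestronglyMeasurable
    · rw [Real.norm_eq_abs, Finset.abs_prod]
      refine Finset.prod_le_one (fun _ _ => abs_nonneg _) fun j _ => ?_
      rw [Finset.abs_prod]
      exact Finset.prod_le_one (fun _ _ => abs_nonneg _) fun i _ => hg1 _ _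
  rw [integral_finsetSum _ fun p _ => hint p]
  have hval : ∀ p : Fin k → Finset (Fin n), ∫ x : Fin n → Ω, (∏ i, A i (p i)) *
        ∏ j, ∏ i ∈ finsetTranspose _ _ p j, g i (x j) ∂(Measure.pi fun _ : Fin n => μ₀) ≤
      (∏ i, b i) * ∏ j, (a ^ (finsetTranspose _ _ p j).card * |c (finsetTranspose _ _ p j)|) := by
    intro p
    rw [integral_const_mul, integral_fintype_prod_eq_prod
      (fun j y => ∏ i ∈ finsetTranspose _ _ p j, g i y)]
    refine (le_abs_self _).trans ?_
    rw [abs_mul, Finset.abs_prod, Finset.abs_prod, Finset.prod_mul_distrib, ← mul_assoc]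
    refine mul_le_mul_of_nonneg_right ?_ (Finset.prod_nonneg fun _ _ => abs_nonneg _)
    calc ∏ i, |A i (p i)| ≤ ∏ i, (b i * a ^ (p i).card) :=
          Finset.prod_le_prod (fun _ _ => abs_nonneg _) fun i _ => hA i _
      _ = _ := by
          rw [Finset.prod_mul_distrib]
          congr 1
          have := prod_prod_mem_transpose p fun _ _ => a
          simpa only [Finset.prod_const] using this
  refine (Finset.sum_le_sum fun p _ => hval p).trans_eq ?_
  rw [← Finset.mul_sum]
  congr 1
  rw [(finsetTranspose (Fin k) (Fin n)).sum_comp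
    (fun q => ∏ j, (a ^ (q j).card * |c (q j)|)), Finset.sum_pow', ← Fintype.piFinset_univ]

theorem likelihood_eq_sum {Ω : Type*} (g : Ω → ℝ) (θ : ℝ) {n : ℕ} (x : Fin n → Ω) :
    likelihood g θ x = ∑ J : Finset (Fin n), θ ^ J.card * ∏ j ∈ J, g (x j) := by
  rw [likelihood, Finset.prod_one_add, Finset.powerset_univ]
  simp_rw [Finset.prod_mul_distrib, Finset.prod_const]

/-! ### Deviation of a likelihood ratio under a change of measure -/

/-- The deviation from `1` of the mean of `L`, where upward deviations are truncated. -/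
noncomputable def truncDev {Y : Type*} [MeasurableSpace Y] (Q : Measure Y) (L : Y → ℝ) : ℝ :=
  if ∫ x, L x ∂Q < 1 then 1 - ∫ x, L x ∂Q else max (∫ x, min (L x - 1) 1 ∂Q) 0

/-- The contribution of the values of `L` outside `[1/2, 2]`. -/
noncomputable def farTail (L : ℝ) : ℝ := max (-Real.log (2 * L)) 0 + max (L - 2) 0

theorem farTail_nonneg (L : ℝ) : 0 ≤ farTail L :=
  add_nonneg (le_max_right _ _) (le_max_right _ _)

theorem truncDev_nonneg {Y : Type*} [MeasurableSpace Y] (Q : Measure Y) (L : Y → ℝ) :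
    0 ≤ truncDev Q L := by
  unfold truncDev
  split_ifs with h
  · linarith
  · exact le_max_right _ _

section Deviation

variable {Y : Type*} [MeasurableSpace Y] {Q : Measure Y} [IsProbabilityMeasure Q] {L w : Y → ℝ}

theorem integrable_farTail (hL : ∀ x, 0 < L x) (hi : Integrable L Q)
    (hlog : Integrable (fun x => Real.log (L x)) Q) :
    Integrable (fun x => farTail (L x)) Q := by
  have h1 : (fun x => farTail (L x)) =
      fun x => max (-(Real.log 2 + Real.log (L x))) 0 + max (L x - 2) 0 := by
    funext x
    rw [farTail, Real.log_mul (by norm_num) (hL x).ne']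
  rw [h1]
  exact (((integrable_const _).add hlog).neg.pos_part).add ((hi.sub (integrable_const _)).pos_part)

theorem neg_log_integral_le (hL : ∀ x, 0 < L x) (hi : Integrable L Q)
    (hlog : Integrable (fun x => Real.log (L x)) Q) (hr : 0 < ∫ x, L x ∂Q) :
    -Real.log (2 * ∫ x, L x ∂Q) ≤ ∫ x, farTail (L x) ∂Q := by
  set r := ∫ x, L x ∂Q with hrdef
  -- Jensen's inequality, through the tangent line of log at the mean `r`.
  have h1 : ∫ x, (-Real.log (2 * r) + 1 - L x / r) ∂Q = -Real.log (2 * r) := by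
    rw [integral_sub (integrable_const _) (hi.div_const _), integral_div, ← hrdef, div_self hr.ne']
    simp
  rw [← h1]
  refine integral_mono ((integrable_const _).sub (hi.div_const _))
    (integrable_farTail hL hi hlog) fun x => ?_
  have h2 := Real.log_le_sub_one_of_pos (div_pos (hL x) hr)
  rw [Real.log_div (hL x).ne' hr.ne'] at h2
  have h3 : -Real.log (2 * L x) ≤ farTail (L x) :=
    (le_max_left _ _).trans (le_add_of_nonneg_right (le_max_right _ _))
  rw [Real.log_mul (by norm_num) (hL x).ne'] at h3
  simp only
  rw [Real.log_mul (by norm_num) hr.ne']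
  linarith

/-- With r the mean, r - 1 - log r is at most 2(1 - r)² for 1/2 ≤ r < 1. Below 1/2, Jensen's
inequality charges the logarithm to values of `L` under 1/2. For r ≥ 1, r - 1 is the truncated mean
d plus an excess coming from values above 2; if d ≥ 0, then log r ≥ log(1 + d) ≥ d - 2d² cancels the
linear part. -/
theorem sub_one_sub_log_integral_le (hL : ∀ x, 0 < L x) (hi : Integrable L Q)
    (hlog : Integrable (fun x => Real.log (L x)) Q) (hr : 0 < ∫ x, L x ∂Q) :
    ∫ x, L x ∂Q - 1 - Real.log (∫ x, L x ∂Q) ≤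
      2 * truncDev Q L ^ 2 + ∫ x, farTail (L x) ∂Q := by
  have ht := neg_log_integral_le hL hi hlog hr
  have ht0 : 0 ≤ ∫ x, farTail (L x) ∂Q := integral_nonneg fun x => farTail_nonneg _
  by_cases hlt : ∫ x, L x ∂Q < 1
  · rw [truncDev, if_pos hlt]
    set r := ∫ x, L x ∂Q
    rcases le_total (1 / 2) r with h | h
    · have h1 := Real.one_sub_inv_le_log_of_pos hr
      have h2 : r - 1 - (1 - r⁻¹) = (1 - r) ^ 2 / r := by field_simp; ring
      have h3 : (1 - r) ^ 2 / r ≤ 2 * (1 - r) ^ 2 := by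
        rw [div_le_iff₀ hr]; nlinarith [sq_nonneg (1 - r)]
      linarith
    · rw [Real.log_mul (by norm_num) hr.ne'] at ht
      have := Real.log_two_lt_d9
      nlinarith
  · rw [truncDev, if_neg hlt]
    have hmin : Integrable (fun x => min (L x - 1) 1) Q :=
      (hi.sub (integrable_const _)).inf (integrable_const _)
    have hmax : Integrable (fun x => max (L x - 2) 0) Q := (hi.sub (integrable_const _)).pos_part
    have hsplit : ∫ x, L x ∂Q - 1 = ∫ x, min (L x - 1) 1 ∂Q + ∫ x, max (L x - 2) 0 ∂Q := by
      rw [← integral_add hmin hmax]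
      have : ∫ x, (L x - 1) ∂Q = ∫ x, L x ∂Q - 1 := by
        rw [integral_sub hi (integrable_const _)]; simp
      rw [← this]
      congr 1; funext x
      rcases le_total (L x) 2 with h | h
      · rw [min_eq_left (by linarith), max_eq_right (by linarith), add_zero]
      · rw [min_eq_right (by linarith), max_eq_left (by linarith)]; ring
    have hle : ∫ x, max (L x - 2) 0 ∂Q ≤ ∫ x, farTail (L x) ∂Q :=
      integral_mono hmax (integrable_farTail hL hi hlog) fun x =>
        le_add_of_nonneg_left (le_max_right _ _)
    set r := ∫ x, L x ∂Q
    set d := ∫ x, min (L x - 1) 1 ∂Q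
    set e := ∫ x, max (L x - 2) 0 ∂Q
    have he : 0 ≤ e := integral_nonneg fun x => le_max_right _ _
    push Not at hlt
    rcases le_total 0 d with hd | hd
    · rw [max_eq_left hd]
      have h1 : Real.log (1 + d) ≤ Real.log r := Real.log_le_log (by linarith) (by linarith)
      have h2 := Real.sub_two_mul_sq_le_log_one_add (x := d) (by linarith)
      linarith
    · rw [max_eq_right hd]
      have := Real.log_nonneg hlt
      linarith

theorem truncDev_le {ε : ℝ} (hL : ∀ x, 0 < L x) (hi : Integrable L Q)
    (hw : Integrable w Q) (hε : 0 < ε) (hw0 : ∀ x, 0 ≤ w x)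
    (hlog : ∀ x, |Real.log (L x)| ≤ ε * w x) :
    truncDev Q L ≤ 2 * ε * ∫ x, w x ∂Q := by
  have h0 : 0 ≤ 2 * ε * ∫ x, w x ∂Q := by
    have := integral_nonneg (μ := Q) (f := w) hw0
    positivity
  rw [truncDev]
  rw [← integral_const_mul]
  rw [← integral_const_mul] at h0
  split_ifs with h
  · have : ∫ x, (1 - L x) ∂Q = 1 - ∫ x, L x ∂Q := by
      rw [integral_sub (integrable_const _) hi]; simp
    rw [← this]
    refine integral_mono ((integrable_const _).sub hi) (hw.const_mul _) fun x => ?_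
    have h1 := Real.log_le_sub_one_of_pos (hL x)
    have h2 := (abs_le.1 (hlog x)).1
    have := hw0 x
    have : 0 ≤ ε * w x := by positivity
    simp only
    linarith
  · refine max_le ?_ h0
    refine integral_mono ((hi.sub (integrable_const _)).inf (integrable_const _))
      (hw.const_mul _) fun x => ?_
    have hpos := hL x
    have h1 := Real.one_sub_inv_le_log_of_pos (hL x)
    have h2 := (abs_le.1 (hlog x)).2
    simp only
    rcases le_total (L x) 2 with h3 | h3
    · refine (min_le_left _ _).trans ?_
      have h4 : (L x - 1) / L x ≤ ε * w x := by
        calc (L x - 1) / L x = 1 - (L x)⁻¹ := by field_simp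
          _ ≤ _ := by linarith
      rw [div_le_iff₀ hpos] at h4
      have := mul_nonneg hε.le (hw0 x)
      nlinarith
    · refine (min_le_right _ _).trans ?_
      have : (L x)⁻¹ ≤ 2⁻¹ := inv_anti₀ (by norm_num) h3
      linarith

theorem sq_integral_le_integral_sq {f : Y → ℝ} (hf : Integrable f Q)
    (hf2 : Integrable (fun x => f x ^ 2) Q) : (∫ x, f x ∂Q) ^ 2 ≤ ∫ x, f x ^ 2 ∂Q := by
  set m := ∫ x, f x ∂Q with hm
  have h1 : ∫ x, (2 * m * f x - m ^ 2) ∂Q = m ^ 2 := by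
    rw [integral_sub (hf.const_mul _) (integrable_const _), integral_const_mul, ← hm]
    simp; ring
  rw [← h1]
  refine integral_mono ((hf.const_mul _).sub (integrable_const _)) hf2 fun x => ?_
  simp only
  nlinarith [sq_nonneg (f x - m)]

/-- A quantity dominated by twice the mean of `w` is either at most `b`, or controlled by the
values of `w` above `b / 4`. -/
theorem sq_le_mul_min_add_integral {X b : ℝ} (hX0 : 0 ≤ X) (hX : X ≤ 2 * ∫ x, w x ∂Q)
    (hb : 1 ≤ b) (hw : Integrable w Q)
    (hw2 : Integrable (fun x => max (w x - b / 4) 0 ^ 2) Q) :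
    X ^ 2 ≤ b * (min X 1 * X) + 16 * ∫ x, max (w x - b / 4) 0 ^ 2 ∂Q := by
  have hint : 0 ≤ ∫ x, max (w x - b / 4) 0 ^ 2 ∂Q := integral_nonneg fun _ => sq_nonneg _
  have hmin : 0 ≤ min X 1 := le_min hX0 zero_le_one
  rcases le_total X b with h | h
  · have : X ≤ b * min X 1 := by
      rcases le_total X 1 with h1 | h1
      · rw [min_eq_left h1]; nlinarith
      · rw [min_eq_right h1]; linarith
    nlinarith
  · have hm : Integrable (fun x => max (w x - b / 4) 0) Q :=
      (hw.sub (integrable_const _)).pos_part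
    have h1 : ∫ x, w x ∂Q - b / 4 ≤ ∫ x, max (w x - b / 4) 0 ∂Q := by
      have : ∫ x, (w x - b / 4) ∂Q = ∫ x, w x ∂Q - b / 4 := by
        rw [integral_sub hw (integrable_const _)]; simp
      rw [← this]
      exact integral_mono (hw.sub (integrable_const _)) hm fun x => le_max_left _ _
    have h2 := sq_integral_le_integral_sq hm hw2
    -- The loss 2 · b/4 is at most X/2, because b ≤ X in this case.
    have h3 : X ≤ 4 * ∫ x, max (w x - b / 4) 0 ∂Q := by linarith
    have h4 : 0 ≤ b * (min X 1 * X) := by positivity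
    nlinarith

/-- The variational bound for the mean of `U` under a measure dominated by `p⁻¹ • P`. -/
theorem integral_le_of_exp_le {P : Measure Y} {p B : ℝ} {U F : Y → ℝ} (hp : 0 < p)
    (hQ : Q ≤ ENNReal.ofReal p⁻¹ • P) (hU : Integrable U Q) (hF : Integrable F P)
    (hUF : ∀ x, Real.exp (U x) ≤ F x) (hB : ∫ x, F x ∂P ≤ Real.exp B) :
    ∫ x, U x ∂Q ≤ Real.log p⁻¹ + B := by
  have hFs : Integrable F (ENNReal.ofReal p⁻¹ • P) := hF.smul_measure ENNReal.ofReal_ne_top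
  have hFQ : Integrable F Q := hFs.mono_measure hQ
  have hF0 : ∀ x, 0 ≤ F x := fun x => (Real.exp_pos _).le.trans (hUF x)
  set m := ∫ x, U x ∂Q with hm
  have h1 : Real.exp m ≤ ∫ x, F x ∂Q := by
    -- Jensen's inequality, through the tangent line of exp at the mean `m`.
    have : ∫ x, Real.exp m * (U x + (1 - m)) ∂Q = Real.exp m := by
      rw [integral_const_mul, integral_add hU (integrable_const _), ← hm]
      simp
    rw [← this]
    refine integral_mono ((hU.add (integrable_const _)).const_mul _) hFQ fun x => ?_
    refine le_trans ?_ (hUF x)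
    have h2 := Real.add_one_le_exp (U x - m)
    calc Real.exp m * (U x + (1 - m)) ≤ Real.exp m * Real.exp (U x - m) := by
          gcongr; linarith
      _ = Real.exp (U x) := by rw [← Real.exp_add]; congr 1; ring
  have h2 : ∫ x, F x ∂Q ≤ p⁻¹ * ∫ x, F x ∂P := by
    refine (integral_mono_measure hQ (Filter.Eventually.of_forall hF0) hFs).trans_eq ?_
    rw [integral_smul_measure, ENNReal.toReal_ofReal (by positivity), smul_eq_mul]
  have h3 : Real.exp m ≤ Real.exp (Real.log p⁻¹ + B) := by
    rw [Real.exp_add, Real.exp_log (by positivity)]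
    exact h1.trans (h2.trans (by gcongr))
  exact Real.exp_le_exp.1 h3

end Deviation

/-! ### The information carried by a set about the members of a family -/

/-- A family of centered functions bounded by `1` with small mixed moments at scale `n^{-1/2}`. -/
structure IsNearlyIndependent {Ω : Type*} [MeasurableSpace Ω] {k : ℕ} (μ₀ : Measure Ω)
    (g : Fin k → Ω → ℝ) (n : ℕ) : Prop where
  measurable : ∀ i, Measurable (g i)
  abs_le_one : ∀ i a, |g i a| ≤ 1
  integral_eq_zero : ∀ i, ∫ a, g i a ∂μ₀ = 0
  one_le : 1 ≤ n
  sum_le : ∑ S : Finset (Fin k), (1 / √(n : ℝ)) ^ S.card * |∫ a, ∏ i ∈ S, g i a ∂μ₀| ≤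
    1 + 1 / (n : ℝ)

/-- With a = 1/√n and ε = ρ√n one has ρ = εa, so the coefficient u ρ^|J| / ε of a nonempty monomial
equals u ε^(|J|-1) a^|J|, at most a^|J| in absolute value. Dividing the deviation of the likelihood
by ε is thus the strongest normalization that linear monomials allow, and every factor satisfies the
coefficient bound of `integral_prod_multiaffine_le` with b = 1 + 2κ. -/
theorem integral_prod_likelihood_le {Ω : Type*} [MeasurableSpace Ω] {k n : ℕ} {μ₀ : Measure Ω}
    [IsProbabilityMeasure μ₀] {g : Fin k → Ω → ℝ} (h : IsNearlyIndependent μ₀ g n) {ρ : ℝ}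
    (hρ : 0 < ρ) (hρn : ρ * √n ≤ 1) {u κ : Fin k → ℝ} (hκ : ∀ i, 0 ≤ κ i)
    (hu : ∀ i, |u i| ≤ 1) :
    ∫ x, ∏ i, (1 + u i / (ρ * √n) * (likelihood (g i) ρ x - 1) +
        κ i * (likelihood (g i) (1 / (2 * √n)) x + likelihood (g i) (-(1 / (2 * √n))) x))
        ∂(Measure.pi fun _ : Fin n => μ₀) ≤ Real.exp (1 + 2 * ∑ i, κ i) := by
  have hn := h.one_le
  have hn0 : (0 : ℝ) < n := by exact_mod_cast hn
  have hs : 0 < √(n : ℝ) := Real.sqrt_pos.2 hn0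
  set a : ℝ := 1 / √n with ha
  have ha0 : 0 < a := by positivity
  have hε : 0 < ρ * √n := by positivity
  let A : Fin k → Finset (Fin n) → ℝ := fun i J =>
    (if J = ∅ then 1 else u i / (ρ * √n) * ρ ^ J.card) +
      κ i * ((1 / (2 * √n)) ^ J.card + (-(1 / (2 * √n))) ^ J.card)
  have hA : ∀ i J, |A i J| ≤ (1 + 2 * κ i) * a ^ J.card := by
    intro i J
    have h1 : |(if J = ∅ then 1 else u i / (ρ * √n) * ρ ^ J.card)| ≤ a ^ J.card := by
      split_ifs with hJ
      · simp [hJ]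
      · obtain ⟨m, hm⟩ := Nat.exists_eq_succ_of_ne_zero (Finset.card_ne_zero.2
          (Finset.nonempty_iff_ne_empty.2 hJ))
        rw [hm]
        have e1 : ρ = ρ * √n * a := by rw [ha]; field_simp
        have e2 : u i / (ρ * √n) * ρ ^ (m + 1) = u i * (ρ * √n) ^ m * a ^ (m + 1) := by
          conv_lhs => rw [show ρ ^ (m + 1) = (ρ * √n * a) ^ (m + 1) by rw [← e1]]
          rw [mul_pow, pow_succ (ρ * √n) m]
          field_simp
        rw [Nat.succ_eq_add_one, e2, abs_mul, abs_mul, abs_of_pos (pow_pos ha0 _),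
          abs_of_pos (pow_pos hε _)]
        refine mul_le_of_le_one_left (by positivity) ?_
        exact mul_le_one₀ (hu i) (by positivity) (pow_le_one₀ hε.le hρn)
    have h2 : ∀ θ : ℝ, |θ| ≤ a → |θ ^ J.card| ≤ a ^ J.card := by
      intro θ hθ; rw [abs_pow]; gcongr
    have h3 : |1 / (2 * √(n : ℝ))| ≤ a := by
      rw [abs_of_pos (by positivity), ha]
      exact one_div_le_one_div_of_le hs (by linarith)
    have h4 := h2 _ h3
    have h5 := h2 (-(1 / (2 * √(n : ℝ)))) (by rwa [abs_neg])
    calc |A i J| ≤ a ^ J.card + κ i * (a ^ J.card + a ^ J.card) := by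
          refine (abs_add_le _ _).trans (add_le_add h1 ?_)
          rw [abs_mul, abs_of_nonneg (hκ i)]
          exact mul_le_mul_of_nonneg_left ((abs_add_le _ _).trans (add_le_add h4 h5)) (hκ i)
      _ = _ := by ring
  have hexp : ∀ (x : Fin n → Ω) i, 1 + u i / (ρ * √n) * (likelihood (g i) ρ x - 1) +
        κ i * (likelihood (g i) (1 / (2 * √n)) x + likelihood (g i) (-(1 / (2 * √n))) x) =
      ∑ J, A i J * ∏ j ∈ J, g i (x j) := by
    intro x i
    have e1 : ∑ J : Finset (Fin n), (if J = ∅ then 1 else u i / (ρ * √n) * ρ ^ J.card) *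
        ∏ j ∈ J, g i (x j) = 1 + u i / (ρ * √n) * (likelihood (g i) ρ x - 1) := by
      rw [likelihood_eq_sum, ← Finset.sum_erase_add _ _ (Finset.mem_univ (∅ : Finset (Fin n))),
        ← Finset.sum_erase_add (Finset.univ : Finset (Finset (Fin n))) _ (Finset.mem_univ ∅)]
      simp only [if_true, Finset.prod_empty, Finset.card_empty, pow_zero, mul_one,
        add_sub_cancel_right]
      rw [add_comm, Finset.mul_sum]
      congr 1
      refine Finset.sum_congr rfl fun J hJ => ?_
      rw [if_neg (Finset.ne_of_mem_erase hJ)]; ring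
    simp only [A, add_mul, Finset.sum_add_distrib, e1]
    congr 1
    rw [likelihood_eq_sum, likelihood_eq_sum, ← Finset.sum_add_distrib, Finset.mul_sum]
    refine Finset.sum_congr rfl fun J _ => by ring
  simp_rw [hexp]
  refine (integral_prod_multiaffine_le μ₀ h.measurable h.abs_le_one hA).trans ?_
  rw [Real.exp_add, mul_comm, Finset.mul_sum, Real.exp_sum]
  refine mul_le_mul ?_ ?_ ?_ (Real.exp_pos _).le
  · calc _ ≤ (1 + 1 / (n : ℝ)) ^ n := by
          gcongr
          exact h.sum_le
      _ ≤ (Real.exp (1 / n)) ^ n := by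
          gcongr
          rw [add_comm]; exact Real.add_one_le_exp _
      _ = Real.exp 1 := by
          rw [← Real.exp_nat_mul]; congr 1; field_simp
  · refine Finset.prod_le_prod (fun i _ => by have := hκ i; positivity) fun i _ => ?_
    rw [add_comm]; exact Real.add_one_le_exp _
  · exact Finset.prod_nonneg fun i _ => by have := hκ i; positivity

/-! ### Truncated deviations under conditioning -/

section Local

variable {Ω : Type*} [MeasurableSpace Ω] {k n : ℕ} {μ₀ : Measure Ω}
    [IsProbabilityMeasure μ₀] {g : Fin k → Ω → ℝ} {ρ : ℝ}

theorem integrable_log_likelihood (hn : 1 ≤ n) {g : Ω → ℝ} (hg : Measurable g)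
    (hg1 : ∀ a, |g a| ≤ 1) (hρ : 0 ≤ ρ) (hρn : ρ * √n ≤ 1 / 2) (Q : Measure (Fin n → Ω))
    [IsFiniteMeasure Q] : Integrable (fun x => Real.log (likelihood g ρ x)) Q := by
  refine Integrable.of_bound (C := ρ * √n * (n + 1))
    (measurable_likelihood hg ρ).log.aestronglyMeasurable (Filter.Eventually.of_forall fun x => ?_)
  refine (abs_log_likelihood_le hn hg1 hρ hρn x).trans ?_
  gcongr
  exact abs_score_le hg1 x

theorem integrable_abs_score {g : Ω → ℝ} (hg : Measurable g)
    (hg1 : ∀ a, |g a| ≤ 1) (Q : Measure (Fin n → Ω))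
    [IsFiniteMeasure Q] : Integrable (fun x => |score g x| + 1) Q := by
  refine (Integrable.of_bound (C := n) ?_ (Filter.Eventually.of_forall fun x => ?_)).add
    (integrable_const 1)
  · exact (measurable_score hg).abs.aestronglyMeasurable
  · rw [Real.norm_eq_abs, abs_abs]; exact abs_score_le hg1 x

/-- The variational bound applied to a sum of signed deviations, the sign for each i following the
side of 1 on which the mean of the likelihood under `Q` lies. The weights `l` stay free and are
chosen afterwards to turn this linear estimate into a quadratic one. -/
theorem sum_mul_truncDev_le (h : IsNearlyIndependent μ₀ g n) (hρ : 0 < ρ)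
    (hρn : ρ * √n ≤ 1 / 16) (Q : Measure (Fin n → Ω)) [IsProbabilityMeasure Q] {p : ℝ}
    (hp : 0 < p) (hQ : Q ≤ ENNReal.ofReal p⁻¹ • Measure.pi fun _ : Fin n => μ₀)
    {l : Fin k → ℝ} (hl0 : ∀ i, 0 ≤ l i) (hl : ∀ i, l i ≤ 1 / 16)
    (hlz : ∀ i, truncDev Q (likelihood (g i) ρ) = 0 → l i = 0) :
    ∑ i, l i * (truncDev Q (likelihood (g i) ρ) / (ρ * √n)) ≤
      Real.log p⁻¹ + (1 + 4096 * ∑ i, l i ^ 2) := by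
  have hn := h.one_le
  have hn0 : (0 : ℝ) < n := by exact_mod_cast hn
  have hs : 0 < √(n : ℝ) := Real.sqrt_pos.2 hn0
  have hs1 : (1 : ℝ) ≤ √n := by rw [Real.one_le_sqrt]; exact_mod_cast hn
  have hε : 0 < ρ * √n := by positivity
  have hρ2 : |ρ| ≤ 1 / 2 := by rw [abs_of_pos hρ]; nlinarith
  set ε := ρ * √n with hεdef
  let L : Fin k → (Fin n → Ω) → ℝ := fun i => likelihood (g i) ρ
  have hLpos : ∀ i x, 0 < L i x := fun i x => likelihood_pos (h.abs_le_one i) hρ2 x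
  have hLint : ∀ i, Integrable (L i) Q := fun i =>
    integrable_likelihood (h.measurable i) (h.abs_le_one i) ρ Q
  let down : Fin k → Prop := fun i => ∫ x, L i x ∂Q < 1
  classical
  let σ : Fin k → ℝ := fun i => if down i then -1 else 1
  let U : Fin k → (Fin n → Ω) → ℝ := fun i x =>
    if down i then -(l i / ε * (L i x - 1)) else l i / ε * min (L i x - 1) 1
  -- The constant is 512 · 2 · 2: one factor 2 from `exp_abs_score_le`, the other bounding exp(1/2),
  -- which is due to the `+ 1` in `w`.
  let F : Fin k → (Fin n → Ω) → ℝ := fun i x =>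
    1 + σ i * l i / ε * (L i x - 1) + 2048 * l i ^ 2 *
      (likelihood (g i) (1 / (2 * √n)) x + likelihood (g i) (-(1 / (2 * √n))) x)
  have hUF : ∀ i x, Real.exp (U i x) ≤ F i x := by
    intro i x
    have hw : 512 * l i ^ 2 * Real.exp ((|score (g i) x| + 1) / 2) ≤ 2048 * l i ^ 2 *
      (likelihood (g i) (1 / (2 * √n)) x + likelihood (g i) (-(1 / (2 * √n))) x) := by
      have e1 := exp_abs_score_le hn (h.abs_le_one i) x
      have e2 := Real.exp_half_le_two
      have e3 : Real.exp ((|score (g i) x| + 1) / 2) =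
          Real.exp (|score (g i) x| / 2) * Real.exp (1 / 2) := by
        rw [← Real.exp_add]; congr 1; ring
      rw [e3]
      have e4 := mul_le_mul e1 e2 (Real.exp_pos _).le ((Real.exp_pos _).le.trans e1)
      have := mul_le_mul_of_nonneg_left e4 (by positivity : 0 ≤ 512 * l i ^ 2)
      linarith
    have hlog := abs_log_likelihood_le hn (h.abs_le_one i) hρ.le (hρn.trans (by norm_num)) x
    have hw0 : 0 ≤ |score (g i) x| + 1 := by positivity
    simp only [U, F, σ]
    split_ifs with hd
    · have := exp_neg_mul_sub_one_le (hLpos i x) hε hρn (hl0 i) (hl i) hw0 hlog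
      refine this.trans ?_
      have e : -1 * l i / ε * (L i x - 1) = -(l i / ε * (L i x - 1)) := by ring
      rw [e]; linarith
    · have := exp_mul_min_sub_one_le (hLpos i x) hε (hl0 i) (hl i) hw0 hlog
      refine this.trans ?_
      rw [one_mul]; linarith
  have hUint : ∀ i, Integrable (U i) Q := by
    intro i
    have e1 : Integrable (fun x => L i x - 1) Q := (hLint i).sub (integrable_const _)
    simp only [U]
    split_ifs with hd
    · exact (e1.const_mul _).neg
    · exact (e1.inf (integrable_const _)).const_mul _
  have hUval : ∀ i, ∫ x, U i x ∂Q = l i * (truncDev Q (L i) / ε) := by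
    intro i
    by_cases hd : ∫ x, L i x ∂Q < 1
    · have e1 : ∀ x, U i x = l i / ε * (1 - L i x) := by
        intro x; simp only [U, down]; rw [if_pos hd]; ring
      simp_rw [e1]
      rw [integral_const_mul, integral_sub (integrable_const _) (hLint i), truncDev, if_pos hd]
      simp; ring
    · have e1 : ∀ x, U i x = l i / ε * min (L i x - 1) 1 := by
        intro x; simp only [U, down]; rw [if_neg hd]
      simp_rw [e1]
      rw [integral_const_mul]
      -- A negative truncated mean is replaced by 0 in `truncDev`; the identity survives because
      -- `hlz` makes the weight vanish there.
      by_cases hz : truncDev Q (L i) = 0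
      · rw [hlz i hz]; simp
      · rw [truncDev, if_neg hd] at hz ⊢
        have : 0 ≤ ∫ x, min (L i x - 1) 1 ∂Q := by
          by_contra hneg
          exact hz (max_eq_right (not_le.1 hneg).le)
        rw [max_eq_left this]; ring
  have hprod : ∫ x, ∏ i, F i x ∂(Measure.pi fun _ : Fin n => μ₀) ≤
      Real.exp (1 + 4096 * ∑ i, l i ^ 2) := by
    have := integral_prod_likelihood_le h hρ (hρn.trans (by norm_num))
      (u := fun i => σ i * l i) (κ := fun i => 2048 * l i ^ 2) (fun i => by positivity)
      (fun i => by
        have : |σ i| = 1 := by simp only [σ]; split_ifs <;> simp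
        rw [abs_mul, this, one_mul, abs_of_nonneg (hl0 i)]
        linarith [hl i])
    rw [← Finset.mul_sum, ← mul_assoc] at this
    norm_num only at this
    exact this
  have hFint : Integrable (fun x => ∏ i, F i x) (Measure.pi fun _ : Fin n => μ₀) := by
    have hmeas : ∀ i, Measurable (F i) := by
      intro i
      have e1 := measurable_likelihood (n := n) (h.measurable i) ρ
      have e2 := measurable_likelihood (n := n) (h.measurable i) (1 / (2 * √n))
      have e3 := measurable_likelihood (n := n) (h.measurable i) (-(1 / (2 * √n)))
      simp only [F, L]
      fun_prop
    have hbd : ∀ i, ∃ C, ∀ x, |F i x| ≤ C := by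
      intro i
      refine ⟨1 + |σ i * l i / ε| * ((1 + |ρ|) ^ n + 1) + 2048 * l i ^ 2 *
        ((1 + |1 / (2 * √n)|) ^ n + (1 + |-(1 / (2 * √(n : ℝ)))|) ^ n), fun x => ?_⟩
      have e1 := abs_likelihood_le (h.abs_le_one i) ρ x
      have e2 := abs_likelihood_le (h.abs_le_one i) (1 / (2 * √n)) x
      have e3 := abs_likelihood_le (h.abs_le_one i) (-(1 / (2 * √n))) x
      simp only [F, L]
      refine (abs_add_le _ _).trans (add_le_add ((abs_add_le _ _).trans
        (add_le_add (abs_one.le) ?_)) ?_)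
      · rw [abs_mul]
        gcongr
        refine (abs_sub _ _).trans ?_
        rw [abs_one]; gcongr
      · rw [abs_mul, abs_of_nonneg (by positivity : 0 ≤ 2048 * l i ^ 2)]
        gcongr
        exact (abs_add_le _ _).trans (add_le_add e2 e3)
    choose C hC using hbd
    refine Integrable.of_bound (C := ∏ i, C i)
      (Finset.measurable_fun_prod _ fun i _ => hmeas i).aestronglyMeasurable
      (Filter.Eventually.of_forall fun x => ?_)
    rw [Real.norm_eq_abs, Finset.abs_prod]
    exact Finset.prod_le_prod (fun _ _ => abs_nonneg _) fun i _ => hC i x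
  have hmain := integral_le_of_exp_le (U := fun x => ∑ i, U i x) hp hQ
    (integrable_finsetSum _ fun i _ => hUint i) hFint (fun x => by
      rw [Real.exp_sum]
      exact Finset.prod_le_prod (fun _ _ => (Real.exp_pos _).le) fun i _ => hUF i x) hprod
  rw [integral_finsetSum _ fun i _ => hUint i] at hmain
  simp_rw [hUval] at hmain
  exact hmain

end Local

/-- The total contribution of atypical samples to the information about the family. -/
noncomputable def tailSum {Ω : Type*} {k n : ℕ} (g : Fin k → Ω → ℝ) (ρ : ℝ) (x : Fin n → Ω) : ℝ :=
  ∑ i, (farTail (likelihood (g i) ρ x) +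
    32 * (ρ * √n) ^ 2 * max (|score (g i) x| + 1 - Real.log k) 0 ^ 2)

theorem tailSum_nonneg {Ω : Type*} {k n : ℕ} (g : Fin k → Ω → ℝ) (ρ : ℝ) (x : Fin n → Ω) :
    0 ≤ tailSum g ρ x :=
  Finset.sum_nonneg fun _ _ => add_nonneg (farTail_nonneg _) (by positivity)

/-! ### Tail estimates and the one-block inequality -/

section Tail

variable {Ω : Type*} [MeasurableSpace Ω] {k n : ℕ} {μ₀ : Measure Ω}
    {g : Fin k → Ω → ℝ} {ρ : ℝ}

theorem integrable_max_score_sq {g : Ω → ℝ} (hg : Measurable g) (hg1 : ∀ a, |g a| ≤ 1) (c : ℝ)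
    (Q : Measure (Fin n → Ω)) [IsFiniteMeasure Q] :
    Integrable (fun x => max (|score g x| + 1 - c) 0 ^ 2) Q := by
  refine Integrable.of_bound (C := (n + 1 + |c|) ^ 2) ?_ (Filter.Eventually.of_forall fun x => ?_)
  · have := measurable_score (n := n) hg
    exact (by fun_prop : Measurable fun x : Fin n → Ω =>
      max (|score g x| + 1 - c) 0 ^ 2).aestronglyMeasurable
  · rw [Real.norm_eq_abs, abs_of_nonneg (sq_nonneg _)]
    have h1 := abs_score_le hg1 x
    have h2 := neg_abs_le c
    gcongr
    exact max_le (by linarith) (by positivity)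

/-- An exponential Chebyshev bound: where `farTail` is nonzero, ε w ≥ |log L| ≥ log 2 > 1/2, so the
extra exponent κ(ε w - 1/2) is nonnegative. -/
theorem farTail_le_exp {L w ε : ℝ} (hL : 0 < L) (hlog : |Real.log L| ≤ ε * w) {κ : ℝ}
    (hκ : 0 ≤ κ) : farTail L ≤ Real.exp ((1 + κ) * (ε * w) - κ / 2) := by
  have hpos := Real.exp_pos ((1 + κ) * (ε * w) - κ / 2)
  have hl2 := Real.log_two_gt_d9
  have key : 1 / 2 ≤ ε * w → ε * w + 1 ≤ Real.exp ((1 + κ) * (ε * w) - κ / 2) ∧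
      Real.exp (ε * w) ≤ Real.exp ((1 + κ) * (ε * w) - κ / 2) := by
    intro h
    have : ε * w ≤ (1 + κ) * (ε * w) - κ / 2 := by nlinarith
    have h2 := Real.exp_le_exp.2 this
    exact ⟨(Real.add_one_le_exp _).trans h2, h2⟩
  rw [farTail]
  have ha := abs_le.1 hlog
  rcases lt_or_ge L (1 / 2) with h1 | h1
  · have h3 : Real.log L ≤ -Real.log 2 := by
      rw [← Real.log_inv]; exact Real.log_le_log hL (by linarith)
    rw [max_eq_right (by linarith : L - 2 ≤ 0), Real.log_mul (by norm_num) hL.ne', add_zero]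
    refine max_le ?_ hpos.le
    have := (key (by linarith)).1
    linarith
  · rw [max_eq_right (a := -Real.log (2 * L)) (by
      have := Real.log_nonneg (x := 2 * L) (by linarith); linarith), zero_add]
    refine max_le ?_ hpos.le
    rcases le_total L 2 with h2 | h2
    · linarith
    · have h3 := Real.log_le_log (by norm_num) h2
      have h4 := (key (by linarith)).2
      have h5 : L ≤ Real.exp (ε * w) := by
        rw [← Real.log_le_iff_le_exp hL]; exact ha.2
      linarith

theorem exp_neg_le_inv {z : ℝ} (hz : 0 < z) : Real.exp (-z) ≤ 1 / z := by
  rw [Real.exp_neg, ← one_div]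
  exact one_div_le_one_div_of_le hz (by linarith [Real.add_one_le_exp z])

theorem integral_farTail_le [IsProbabilityMeasure μ₀] (hn : 1 ≤ n) {g : Ω → ℝ} (hg : Measurable g)
    (hg1 : ∀ a, |g a| ≤ 1) (h0 : ∫ a, g a ∂μ₀ = 0) (hρ : 0 < ρ) (hρn : ρ * √n ≤ 1 / 16) (hk : 2 ≤ k)
    (hρk : (ρ * √n) ^ 2 * Real.log k ≤ 1 / 64) :
    ∫ x, farTail (likelihood g ρ x) ∂(Measure.pi fun _ : Fin n => μ₀) ≤
      128 * (ρ * √n) ^ 2 / k := by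
  have hs1 : (1 : ℝ) ≤ √n := by rw [Real.one_le_sqrt]; exact_mod_cast hn
  have hε : 0 < ρ * √n := by positivity
  have hρ2 : |ρ| ≤ 1 / 2 := by rw [abs_of_pos hρ]; nlinarith
  have hk0 : (0 : ℝ) < k := by positivity
  have habs := fun x => abs_log_likelihood_le (n := n) hn hg1 hρ.le (hρn.trans (by norm_num)) x
  have hlogi := integrable_log_likelihood (n := n) hn hg hg1 hρ.le (hρn.trans (by norm_num))
    (Measure.pi fun _ : Fin n => μ₀)
  set ε := ρ * √n with hεdef
  set u := 1 / ε with hu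
  have hu16 : 16 ≤ u := by
    rw [hu, le_div_iff₀ hε]; linarith
  have hεu : ε = 1 / u := by rw [hu]; field_simp
  have hu0 : 0 < u := by linarith
  set κ := u ^ 2 / 8 with hκ
  set α := (1 + κ) * ε with hα
  have hα' : α = 1 / u + u / 8 := by rw [hα, hκ, hεu]; field_simp
  have h1 : ∫ x, farTail (likelihood g ρ x) ∂(Measure.pi fun _ : Fin n => μ₀) ≤
      ∫ x, Real.exp (α - κ / 2) * Real.exp (α * |score g x|)
        ∂(Measure.pi fun _ : Fin n => μ₀) := by
    refine integral_mono (integrable_farTail (fun x => likelihood_pos hg1 hρ2 x)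
      (integrable_likelihood hg hg1 ρ _) hlogi)
      ((integrable_exp_mul_abs_score hg hg1 α _).const_mul _) fun x => ?_
    refine (farTail_le_exp (likelihood_pos hg1 hρ2 x) (habs x) (κ := κ) (by positivity)).trans_eq ?_
    rw [← Real.exp_add]; congr 1; rw [hα]; ring
  rw [integral_const_mul] at h1
  have h2 := integral_exp_mul_abs_score_le μ₀ hn hg hg1 h0 α
  -- With κ = u²/8 the leading terms are -u²/16 + u²/128. The exponent is split in two halves: one
  -- yields the factor 1/k by the bound on ε² log k, the other the factor ε² by `exp_neg_le_inv`.
  have h3 : α - κ / 2 + α ^ 2 / 2 ≤ -(u ^ 2 / 64) + -(u ^ 2 / 64) := by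
    have hinv : 1 / u ≤ 1 / 16 := one_div_le_one_div_of_le (by norm_num) hu16
    have hinv0 : 0 < 1 / u := by positivity
    have huu : 1 / u * u = 1 := by field_simp
    rw [hα', hκ]
    nlinarith
  have h4 : Real.exp (-(u ^ 2 / 64)) ≤ 1 / k := by
    have : Real.log k ≤ u ^ 2 / 64 := by
      rw [hu, div_pow, one_pow, div_div, le_div_iff₀ (by positivity)]
      linarith
    calc Real.exp (-(u ^ 2 / 64)) ≤ Real.exp (-Real.log k) := by gcongr
      _ = 1 / k := by rw [Real.exp_neg, Real.exp_log hk0, one_div]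
  have h5 : Real.exp (-(u ^ 2 / 64)) ≤ 64 * ε ^ 2 := by
    refine (exp_neg_le_inv (by positivity)).trans_eq ?_
    rw [hεu]; field_simp
  calc _ ≤ Real.exp (α - κ / 2) * (2 * Real.exp (α ^ 2 / 2)) := h1.trans (by gcongr)
    _ = 2 * Real.exp (α - κ / 2 + α ^ 2 / 2) := by rw [Real.exp_add]; ring
    _ ≤ 2 * Real.exp (-(u ^ 2 / 64) + -(u ^ 2 / 64)) := by gcongr
    _ = 2 * (Real.exp (-(u ^ 2 / 64)) * Real.exp (-(u ^ 2 / 64))) := by rw [Real.exp_add]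
    _ ≤ 2 * (64 * ε ^ 2 * (1 / k)) := by gcongr
    _ = _ := by ring

theorem integral_max_score_sq_le [IsProbabilityMeasure μ₀] (hn : 1 ≤ n) {g : Ω → ℝ}
    (hg : Measurable g) (hg1 : ∀ a, |g a| ≤ 1) (h0 : ∫ a, g a ∂μ₀ = 0) (hk : 2 ≤ k) :
    ∫ x, max (|score g x| + 1 - Real.log k) 0 ^ 2 ∂(Measure.pi fun _ : Fin n => μ₀) ≤ 24 / k := by
  have hk0 : (0 : ℝ) < k := by positivity
  have h1 : ∫ x, max (|score g x| + 1 - Real.log k) 0 ^ 2 ∂(Measure.pi fun _ : Fin n => μ₀) ≤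
      ∫ x, 2 * Real.exp (1 - Real.log k) * Real.exp (1 * |score g x|)
        ∂(Measure.pi fun _ : Fin n => μ₀) := by
    refine integral_mono (integrable_max_score_sq hg hg1 _ _)
      ((integrable_exp_mul_abs_score hg hg1 1 _).const_mul _) fun x => ?_
    simp only
    rw [mul_assoc, ← Real.exp_add]
    have e : 1 - Real.log k + 1 * |score g x| = |score g x| + 1 - Real.log k := by ring
    rw [e]
    set z := |score g x| + 1 - Real.log k
    rcases le_total z 0 with hz | hz
    · rw [max_eq_right hz]; have := Real.exp_pos z; norm_num; positivity
    · rw [max_eq_left hz]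
      have := Real.quadratic_le_exp_of_nonneg hz
      nlinarith
  rw [integral_const_mul] at h1
  have h2 := integral_exp_mul_abs_score_le μ₀ hn hg hg1 h0 1
  have h3 : Real.exp 1 ≤ 2.7182818286 := Real.exp_one_lt_d9.le
  have h4 : Real.exp ((1 : ℝ) ^ 2 / 2) ≤ 2 := by rw [one_pow]; exact Real.exp_half_le_two
  have h5 : Real.exp (1 - Real.log k) = Real.exp 1 / k := by
    rw [Real.exp_sub, Real.exp_log hk0]
  rw [h5] at h1
  calc _ ≤ 2 * (Real.exp 1 / k) * (2 * Real.exp ((1 : ℝ) ^ 2 / 2)) := h1.trans (by gcongr)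
    _ ≤ 2 * (2.7182818286 / k) * (2 * 2) := by gcongr
    _ ≤ 24 / k := by rw [← sub_nonneg]; field_simp; norm_num

theorem integrable_farTail_likelihood (hn : 1 ≤ n) {g : Ω → ℝ} (hg : Measurable g)
    (hg1 : ∀ a, |g a| ≤ 1) (hρ : 0 < ρ) (hρn : ρ * √n ≤ 1 / 2) (Q : Measure (Fin n → Ω))
    [IsProbabilityMeasure Q] : Integrable (fun x => farTail (likelihood g ρ x)) Q := by
  have hs1 : (1 : ℝ) ≤ √n := by rw [Real.one_le_sqrt]; exact_mod_cast hn
  have hρ2 : |ρ| ≤ 1 / 2 := by rw [abs_of_pos hρ]; nlinarith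
  exact integrable_farTail (fun x => likelihood_pos hg1 hρ2 x)
    (integrable_likelihood hg hg1 ρ _) (integrable_log_likelihood hn hg hg1 hρ.le hρn _)

theorem integral_tailSum (h : IsNearlyIndependent μ₀ g n) (hρ : 0 < ρ)
    (hρn : ρ * √n ≤ 1 / 16) (Q : Measure (Fin n → Ω)) [IsProbabilityMeasure Q] :
    ∫ x, tailSum g ρ x ∂Q = ∑ i, (∫ x, farTail (likelihood (g i) ρ x) ∂Q +
      32 * (ρ * √n) ^ 2 * ∫ x, max (|score (g i) x| + 1 - Real.log k) 0 ^ 2 ∂Q) := by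
  have h1 := fun i => integrable_farTail_likelihood h.one_le (h.measurable i) (h.abs_le_one i) hρ
    (hρn.trans (by norm_num)) Q
  have h2 := fun i => (integrable_max_score_sq (h.measurable i) (h.abs_le_one i)
    (Real.log k) Q).const_mul (32 * (ρ * √n) ^ 2)
  refine (integral_finsetSum _ fun i _ => (h1 i).add (h2 i)).trans ?_
  refine Finset.sum_congr rfl fun i _ => ?_
  rw [← integral_const_mul]
  exact integral_add (h1 i) (h2 i)

theorem integrable_tailSum (h : IsNearlyIndependent μ₀ g n) (hρ : 0 < ρ)
    (hρn : ρ * √n ≤ 1 / 16) (Q : Measure (Fin n → Ω)) [IsProbabilityMeasure Q] :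
    Integrable (tailSum g ρ) Q :=
  integrable_finsetSum _ fun i _ =>
    (integrable_farTail_likelihood h.one_le (h.measurable i) (h.abs_le_one i) hρ
      (hρn.trans (by norm_num)) Q).add
    ((integrable_max_score_sq (h.measurable i) (h.abs_le_one i) (Real.log k) Q).const_mul _)

theorem half_le_log {k : ℕ} (hk : 2 ≤ k) : 1 / 2 ≤ Real.log k := by
  have h1 := Real.log_two_gt_d9
  have h2 : Real.log 2 ≤ Real.log k := Real.log_le_log (by norm_num) (by exact_mod_cast hk)
  linarith

theorem integral_tailSum_le [IsProbabilityMeasure μ₀] (h : IsNearlyIndependent μ₀ g n) (hρ : 0 < ρ)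
    (hρn : ρ * √n ≤ 1 / 16) (hk : 2 ≤ k) (hρk : (ρ * √n) ^ 2 * Real.log k ≤ 1 / 64) :
    ∫ x, tailSum g ρ x ∂(Measure.pi fun _ : Fin n => μ₀) ≤
      1792 * ((ρ * √n) ^ 2 * Real.log k) := by
  have hk0 : (0 : ℝ) < k := by positivity
  rw [integral_tailSum h hρ hρn]
  calc _ ≤ ∑ _i : Fin k, (128 * (ρ * √n) ^ 2 / k + 32 * (ρ * √n) ^ 2 * (24 / k)) := by
        refine Finset.sum_le_sum fun i _ => add_le_add
          (integral_farTail_le h.one_le (h.measurable i) (h.abs_le_one i) (h.integral_eq_zero i)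
            hρ hρn hk hρk) ?_
        gcongr
        exact integral_max_score_sq_le h.one_le (h.measurable i) (h.abs_le_one i)
          (h.integral_eq_zero i) hk
    _ = 896 * (ρ * √n) ^ 2 := by
        rw [Finset.sum_const, Finset.card_univ, Fintype.card_fin, nsmul_eq_mul]
        field_simp; ring
    _ ≤ _ := by nlinarith [half_le_log hk, sq_nonneg (ρ * √n)]

/-- The bounded weights `l` control only the sum of min(X_i, 1) X_i, where X_i is the truncated
deviation divided by ε. Passing to X_i² costs a factor of order log k, the level above which the
scores are charged to `tailSum`. -/
theorem sum_sub_one_sub_log_le [IsProbabilityMeasure μ₀] (h : IsNearlyIndependent μ₀ g n)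
    (hρ : 0 < ρ) (hρn : ρ * √n ≤ 1 / 16) (hk : 2 ≤ k) (Q : Measure (Fin n → Ω)) [IsProbabilityMeasure Q]
    {p : ℝ} (hp : 0 < p) (hQ : Q ≤ ENNReal.ofReal p⁻¹ • Measure.pi fun _ : Fin n => μ₀) :
    ∑ i, (∫ x, likelihood (g i) ρ x ∂Q - 1 - Real.log (∫ x, likelihood (g i) ρ x ∂Q)) ≤
      131072 * ((ρ * √n) ^ 2 * Real.log k) * (Real.log p⁻¹ + 1) + ∫ x, tailSum g ρ x ∂Q := by
  have hn := h.one_le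
  have hs1 : (1 : ℝ) ≤ √n := by rw [Real.one_le_sqrt]; exact_mod_cast hn
  have hε : 0 < ρ * √n := by positivity
  have hρ2 : |ρ| ≤ 1 / 2 := by rw [abs_of_pos hρ]; nlinarith
  have hlogk := half_le_log hk
  rw [integral_tailSum h hρ hρn]
  set ε := ρ * √n with hεdef
  set X : Fin k → ℝ := fun i => truncDev Q (likelihood (g i) ρ) / ε with hX
  have hX0 : ∀ i, 0 ≤ X i := fun i => div_nonneg (truncDev_nonneg _ _) hε.le
  have hLpos : ∀ i x, 0 < likelihood (n := n) (g i) ρ x :=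
    fun i x => likelihood_pos (h.abs_le_one i) hρ2 x
  have hLint : ∀ i, Integrable (likelihood (g i) ρ) Q := fun i =>
    integrable_likelihood (h.measurable i) (h.abs_le_one i) ρ Q
  have hsum : ∑ i, min (X i) 1 * X i ≤ 16384 * (Real.log p⁻¹ + 1) := by
    -- With weight c = 1/8192 the error 4096 c² is c/2, so half of the left side survives.
    have h1 := sum_mul_truncDev_le h hρ hρn Q hp hQ (l := fun i => 1 / 8192 * min (X i) 1)
      (fun i => mul_nonneg (by norm_num) (le_min (hX0 i) zero_le_one))
      (fun i => by have := min_le_right (X i) 1; linarith)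
      (fun i hi => by simp [hX, hi])
    have h2 : ∑ i, (1 / 8192 * min (X i) 1) ^ 2 ≤
        ∑ i, (1 / 8192) ^ 2 * (min (X i) 1 * X i) := by
      refine Finset.sum_le_sum fun i _ => ?_
      rw [mul_pow, sq (min (X i) 1)]
      have := min_le_left (X i) 1
      have : 0 ≤ min (X i) 1 := le_min (hX0 i) zero_le_one
      gcongr
    have h3 : ∑ i, 1 / 8192 * min (X i) 1 * (truncDev Q (likelihood (g i) ρ) / ε) =
        1 / 8192 * ∑ i, min (X i) 1 * X i := by
      rw [Finset.mul_sum]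
      exact Finset.sum_congr rfl fun i _ => by simp only [hX]; ring
    rw [h3] at h1
    rw [← Finset.mul_sum] at h2
    linarith
  have hterm : ∀ i, ∫ x, likelihood (g i) ρ x ∂Q - 1 - Real.log (∫ x, likelihood (g i) ρ x ∂Q) ≤
      8 * (ε ^ 2 * Real.log k) * (min (X i) 1 * X i) +
      (∫ x, farTail (likelihood (g i) ρ x) ∂Q +
      32 * ε ^ 2 * ∫ x, max (|score (g i) x| + 1 - Real.log k) 0 ^ 2 ∂Q) := by
    intro i
    have hr : 0 < ∫ x, likelihood (g i) ρ x ∂Q := by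
      rw [integral_pos_iff_support_of_nonneg (fun x => (hLpos i x).le) (hLint i)]
      have : Function.support (fun x => likelihood (n := n) (g i) ρ x) = Set.univ := by
        ext x; simp [(hLpos i x).ne']
      rw [this]; simp
    have hw := integrable_abs_score (n := n) (h.measurable i) (h.abs_le_one i) Q
    have h1 := sub_one_sub_log_integral_le (hLpos i) (hLint i)
      (integrable_log_likelihood hn (h.measurable i) (h.abs_le_one i) hρ.le
        (hρn.trans (by norm_num)) Q) hr
    have h2 : X i ≤ 2 * ∫ x, (|score (g i) x| + 1) ∂Q := by
      simp only [hX]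
      rw [div_le_iff₀ hε]
      have := truncDev_le (hLpos i) (hLint i) hw hε (fun x => by positivity)
        (fun x => abs_log_likelihood_le hn (h.abs_le_one i) hρ.le (hρn.trans (by norm_num)) x)
      linarith
    -- The level b/4 is then log k, the cutoff in `tailSum`; the coefficient 32 there is 2 · 16.
    have h3 := sq_le_mul_min_add_integral (b := 4 * Real.log k) (hX0 i) h2 (by linarith) hw
      (by
        have := integrable_max_score_sq (n := n) (h.measurable i) (h.abs_le_one i)
          (4 * Real.log k / 4) Q
        exact this)
    rw [mul_div_cancel_left₀ _ (by norm_num : (4 : ℝ) ≠ 0)] at h3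
    have h4 : truncDev Q (likelihood (g i) ρ) = ε * X i := by simp only [hX]; field_simp
    rw [h4, mul_pow] at h1
    have h5 := mul_le_mul_of_nonneg_left h3 (by positivity : 0 ≤ 2 * ε ^ 2)
    linarith
  refine (Finset.sum_le_sum fun i _ => hterm i).trans ?_
  rw [Finset.sum_add_distrib, ← Finset.mul_sum]
  have := mul_le_mul_of_nonneg_left hsum (by positivity : 0 ≤ 8 * (ε ^ 2 * Real.log k))
  linarith

end Tail

/-! ### Relative entropy on finite sets -/

/-- The Fenchel–Young inequality behind the variational formula for relative entropy, with test
function `f`. -/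
theorem relEntropy_pointwise {p q : ℝ} (hp : 0 ≤ p) (hq : 0 ≤ q) (hpq : q = 0 → p = 0) (f : ℝ) :
    p * f - q * Real.exp f + p ≤ p * Real.log (p / q) := by
  rcases hp.eq_or_lt with rfl | hp
  · have := Real.exp_pos f
    simp only [zero_mul, zero_sub, add_zero]
    nlinarith
  · have hq' : 0 < q := lt_of_le_of_ne hq fun h => hp.ne' (hpq h.symm)
    have h1 := Real.log_le_sub_one_of_pos (x := q / p * Real.exp f) (by positivity)
    rw [Real.log_mul (by positivity) (by positivity), Real.log_exp,
      Real.log_div hq'.ne' hp.ne'] at h1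
    rw [Real.log_div hp.ne' hq'.ne']
    have h2 := mul_le_mul_of_nonneg_left h1 hp.le
    have h3 : p * (q / p * Real.exp f - 1) = q * Real.exp f - p := by field_simp
    rw [h3] at h2
    linarith

/-- The test function is log 2 off `E` and 0 on it; this gives log 2 · (1 - p(E)) - 1 + q(E). -/
theorem le_sum_mul_log_div {T : Type*} [Fintype T] {p q : T → ℝ} (hp : ∀ τ, 0 ≤ p τ)
    (hq : ∀ τ, 0 ≤ q τ) (hpq : ∀ τ, q τ = 0 → p τ = 0) (hp1 : ∑ τ, p τ = 1) (hq1 : ∑ τ, q τ = 1)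
    (E : T → Prop) [DecidablePred E] (hE : 2 / 3 ≤ ∑ τ with E τ, q τ) :
    Real.log 2 * (1 - ∑ τ with E τ, p τ) - 1 / 3 ≤ ∑ τ, p τ * Real.log (p τ / q τ) := by
  have h1 : ∑ τ, (p τ * (if E τ then 0 else Real.log 2) -
      q τ * Real.exp (if E τ then 0 else Real.log 2) + p τ) ≤ ∑ τ, p τ * Real.log (p τ / q τ) :=
    Finset.sum_le_sum fun τ _ => relEntropy_pointwise (hp τ) (hq τ) (hpq τ) _
  refine le_trans ?_ h1
  have h2 : ∀ τ, p τ * (if E τ then 0 else Real.log 2) -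
      q τ * Real.exp (if E τ then 0 else Real.log 2) + p τ =
      (Real.log 2 * p τ - Real.log 2 * (if E τ then p τ else 0)) -
      (2 * q τ - if E τ then q τ else 0) + p τ := by
    intro τ
    split_ifs
    · rw [Real.exp_zero]; ring
    · rw [Real.exp_log (by norm_num)]; ring
  simp_rw [h2]
  rw [Finset.sum_add_distrib, Finset.sum_sub_distrib, Finset.sum_sub_distrib,
    Finset.sum_sub_distrib, ← Finset.mul_sum, ← Finset.mul_sum, ← Finset.mul_sum, hp1, hq1,
    ← Finset.sum_filter, ← Finset.sum_filter]
  linarith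

theorem sum_negMulLog_le {T : Type*} [Fintype T] [Nonempty T] {p : T → ℝ} (hp : ∀ τ, 0 ≤ p τ)
    (hp1 : ∑ τ, p τ = 1) : ∑ τ, Real.negMulLog (p τ) ≤ Real.log (Fintype.card T) := by
  have hT : (0 : ℝ) < Fintype.card T := by exact_mod_cast Fintype.card_pos
  have h1 : ∑ τ, (p τ * 0 - (1 / (Fintype.card T : ℝ)) * Real.exp 0 + p τ) ≤
      ∑ τ, p τ * Real.log (p τ / (1 / (Fintype.card T : ℝ))) :=
    Finset.sum_le_sum fun τ _ => relEntropy_pointwise (hp τ) (by positivity)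
      (fun h => absurd h (by positivity)) _
  have h2 : ∀ τ, p τ * Real.log (p τ / (1 / (Fintype.card T : ℝ))) =
      p τ * Real.log (Fintype.card T) - Real.negMulLog (p τ) := by
    intro τ
    rcases (hp τ).eq_or_lt with h | h
    · rw [← h]; simp
    · rw [Real.log_div h.ne' (by positivity), Real.log_div (by norm_num) hT.ne', Real.log_one,
        Real.negMulLog]
      ring
  simp_rw [h2] at h1
  simp only [mul_zero, Real.exp_zero, mul_one] at h1
  rw [Finset.sum_add_distrib, Finset.sum_sub_distrib, Finset.sum_sub_distrib, ← Finset.sum_mul,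
    hp1, one_mul, Finset.sum_const, Finset.sum_const, Finset.card_univ, nsmul_zero,
    nsmul_eq_mul, mul_one_div_cancel hT.ne'] at h1
  linarith

/-! ### Protocols with rectangular transcripts -/

/-- A transcript map on `N` independent inputs whose fibers are measurable rectangles. -/
structure IsRectangular {Y T : Type*} [MeasurableSpace Y] {N : ℕ} (tr : (Fin N → Y) → T)
    (R : Fin N → T → Set Y) : Prop where
  measurableSet : ∀ b τ, MeasurableSet (R b τ)
  eq_iff : ∀ X τ, tr X = τ ↔ ∀ b, X b ∈ R b τ

namespace IsRectangular

variable {Y T : Type*} [MeasurableSpace Y] {N : ℕ} {tr : (Fin N → Y) → T}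
  {R : Fin N → T → Set Y}

theorem preimage_eq (h : IsRectangular tr R) (τ : T) :
    tr ⁻¹' {τ} = Set.univ.pi fun b => R b τ := by
  ext X; simp [h.eq_iff]

theorem measureReal_preimage (h : IsRectangular tr R) (ν : Fin N → Measure Y)
    [∀ b, IsFiniteMeasure (ν b)] (τ : T) :
    (Measure.pi ν).real (tr ⁻¹' {τ}) = ∏ b, (ν b).real (R b τ) := by
  rw [h.preimage_eq, measureReal_def, Measure.pi_pi, ENNReal.toReal_prod]
  rfl

theorem sum_filter_prod [Fintype T] (h : IsRectangular tr R) (ν : Fin N → Measure Y)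
    [∀ b, IsFiniteMeasure (ν b)] (E : T → Prop) [DecidablePred E] :
    ∑ τ with E τ, ∏ b, (ν b).real (R b τ) = (Measure.pi ν).real {X | E (tr X)} := by
  simp_rw [← h.measureReal_preimage ν]
  rw [sum_measureReal_preimage_singleton]
  · congr 1; ext X; simp
  · intro τ _
    rw [h.preimage_eq]
    exact MeasurableSet.univ_pi fun b => h.measurableSet b τ

theorem sum_prod [Fintype T] (h : IsRectangular tr R) (ν : Fin N → Measure Y)
    [∀ b, IsFiniteMeasure (ν b)] :
    ∑ τ, ∏ b, (ν b).real (R b τ) = ∏ b, (ν b).real Set.univ := by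
  have := h.sum_filter_prod ν fun _ => True
  simp only [Finset.filter_true, Set.ofPred_true] at this
  rw [this, measureReal_def, Measure.pi_univ, ENNReal.toReal_prod]
  rfl

/-- Rectangularity makes sense of the transcript when block `b` alone has law `ν`: the fibers still
partition the inputs, so their masses add up to the total mass. Besides the alternatives it is
applied to a finite measure recording the tails. -/
theorem sum_hybrid [Fintype T] (h : IsRectangular tr R) (P ν : Measure Y)
    [IsProbabilityMeasure P] [IsFiniteMeasure ν] (b : Fin N) :
    ∑ τ, ν.real (R b τ) * ∏ c ∈ Finset.univ.erase b, P.real (R c τ) = ν.real Set.univ := by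
  have hfin : ∀ c, IsFiniteMeasure (Function.update (fun _ : Fin N => P) b ν c) := by
    intro c
    rcases eq_or_ne c b with rfl | hc
    · rw [Function.update_self]; infer_instance
    · rw [Function.update_of_ne hc]; infer_instance
  have h1 := h.sum_prod (Function.update (fun _ : Fin N => P) b ν)
  have h2 : ∀ A : Fin N → Set Y, ∏ c, (Function.update (fun _ : Fin N => P) b ν c).real (A c) =
      ν.real (A b) * ∏ c ∈ Finset.univ.erase b, P.real (A c) := by
    intro A
    rw [← Finset.mul_prod_erase _ _ (Finset.mem_univ b), Function.update_self]
    congr 1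
    refine Finset.prod_congr rfl fun c hc => ?_
    rw [Function.update_of_ne (Finset.ne_of_mem_erase hc)]
  rw [h2 fun _ => Set.univ] at h1
  simp_rw [h2] at h1
  rw [h1]; simp

end IsRectangular

theorem measureReal_withDensity_ofReal {Y : Type*} [MeasurableSpace Y] {P : Measure Y}
    {f : Y → ℝ} (hf : Integrable f P) (hf0 : ∀ x, 0 ≤ f x) {S : Set Y} (hS : MeasurableSet S) :
    (P.withDensity fun x => ENNReal.ofReal (f x)).real S = ∫ x in S, f x ∂P := by
  rw [measureReal_def, withDensity_apply _ hS, ← ofReal_integral_eq_lintegral_ofReal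
    hf.integrableOn (Filter.Eventually.of_forall hf0), ENNReal.toReal_ofReal]
  exact integral_nonneg hf0

theorem integral_cond_eq_div {Y : Type*} [MeasurableSpace Y] {P : Measure Y}
    (f : Y → ℝ) (S : Set Y) :
    ∫ x, f x ∂(ProbabilityTheory.cond P S) = (∫ x in S, f x ∂P) / P.real S := by
  rw [ProbabilityTheory.cond, integral_smul_measure, ENNReal.toReal_inv, smul_eq_mul,
    measureReal_def]
  ring

theorem cond_le_smul {Y : Type*} [MeasurableSpace Y] {P : Measure Y} [IsFiniteMeasure P]
    {S : Set Y} (hS : 0 < P.real S) :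
    ProbabilityTheory.cond P S ≤ ENNReal.ofReal (P.real S)⁻¹ • P := by
  rw [ProbabilityTheory.cond, ENNReal.ofReal_inv_of_pos hS, ofReal_measureReal]
  intro A
  simp only [Measure.smul_apply, smul_eq_mul]
  gcongr
  exact Measure.restrict_le_self

/-! ### Relative entropy of a rectangular transcript -/

section Information

variable {Ω : Type*} [MeasurableSpace Ω] {k n N : ℕ} {μ₀ : Measure Ω} {g : Fin k → Ω → ℝ} {ρ : ℝ}
  {T : Type*} [Fintype T] {tr : (Fin N → Fin n → Ω) → T} {R : Fin N → T → Set (Fin n → Ω)}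

theorem sum_relEntropy_le [Nonempty T] [IsProbabilityMeasure μ₀] (h : IsNearlyIndependent μ₀ g n)
    (hρ : 0 < ρ) (hρn : ρ * √n ≤ 1 / 16) (hk : 2 ≤ k)
    (hρk : (ρ * √n) ^ 2 * Real.log k ≤ 1 / 64) (hrect : IsRectangular tr R)
    {P : Measure (Fin n → Ω)} (hP : P = Measure.pi fun _ : Fin n => μ₀)
    {ν : Fin k → Measure (Fin n → Ω)} [∀ i, IsProbabilityMeasure (ν i)]
    (hν : ∀ i, ν i = P.withDensity fun x => ENNReal.ofReal (likelihood (g i) ρ x)) :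
    ∑ i, ∑ τ, (∏ b, P.real (R b τ)) *
        Real.log ((∏ b, P.real (R b τ)) / ∏ b, (ν i).real (R b τ)) ≤
      131072 * ((ρ * √n) ^ 2 * Real.log k) * (Real.log (Fintype.card T) + 2 * N) := by
  have hn := h.one_le
  have hs1 : (1 : ℝ) ≤ √n := by rw [Real.one_le_sqrt]; exact_mod_cast hn
  have hρ2 : |ρ| ≤ 1 / 2 := by rw [abs_of_pos hρ]; nlinarith
  have hPprob : IsProbabilityMeasure P := by rw [hP]; infer_instance
  have hlogk := half_le_log hk
  set K := 131072 * ((ρ * √n) ^ 2 * Real.log k) with hK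
  have hK0 : 0 ≤ K := by positivity
  have hLpos : ∀ i x, 0 < likelihood (n := n) (g i) ρ x :=
    fun i x => likelihood_pos (h.abs_le_one i) hρ2 x
  have hLint : ∀ i, Integrable (likelihood (g i) ρ) P := fun i =>
    integrable_likelihood (h.measurable i) (h.abs_le_one i) ρ P
  have htail := integrable_tailSum h hρ hρn P
  -- Viewed as a measure, the tail sums over all transcripts by `sum_hybrid`, so each block pays for
  -- it only once, whatever the number of transcripts.
  let νt : Measure (Fin n → Ω) := P.withDensity fun x => ENNReal.ofReal (tailSum g ρ x)
  have hνt : IsFiniteMeasure νt := isFiniteMeasure_withDensity_ofReal htail.2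
  have hνR : ∀ i b τ, (ν i).real (R b τ) = ∫ x in R b τ, likelihood (g i) ρ x ∂P := by
    intro i b τ
    rw [hν i]
    exact measureReal_withDensity_ofReal (hLint i) (fun x => (hLpos i x).le)
      (hrect.measurableSet b τ)
  have hνtR : ∀ b τ, νt.real (R b τ) = ∫ x in R b τ, tailSum g ρ x ∂P := fun b τ =>
    measureReal_withDensity_ofReal htail (tailSum_nonneg g ρ) (hrect.measurableSet b τ)
  have hνtuniv : νt.real Set.univ ≤ K := by
    rw [measureReal_withDensity_ofReal htail (tailSum_nonneg g ρ) MeasurableSet.univ,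
      setIntegral_univ, hP]
    refine (integral_tailSum_le h hρ hρn hk hρk).trans ?_
    rw [hK]
    gcongr
    norm_num
  set q : Fin N → T → ℝ := fun b τ => P.real (R b τ) with hq
  set p : T → ℝ := fun τ => ∏ b, q b τ with hp
  have hq0 : ∀ b τ, 0 ≤ q b τ := fun _ _ => measureReal_nonneg
  have hp0 : ∀ τ, 0 ≤ p τ := fun τ => Finset.prod_nonneg fun b _ => hq0 b τ
  have hp1 : ∑ τ, p τ = 1 := by
    have := hrect.sum_prod fun _ => P
    simpa using this
  -- the comparison of a single block with the base measure
  let hyb : Measure (Fin n → Ω) → Fin N → T → ℝ := fun m b τ =>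
    m.real (R b τ) * ∏ c ∈ Finset.univ.erase b, q c τ
  have hpoint : ∀ τ, ∑ i, p τ * Real.log (p τ / ∏ b, (ν i).real (R b τ)) ≤
      ∑ b, ∑ i, (p τ - hyb (ν i) b τ) + K * (Real.negMulLog (p τ) + N * p τ) +
        ∑ b, hyb νt b τ := by
    intro τ
    have hsplit : ∀ b, p τ = q b τ * ∏ c ∈ Finset.univ.erase b, q c τ := fun b =>
      (Finset.mul_prod_erase _ _ (Finset.mem_univ b)).symm
    have htn : ∀ b, 0 ≤ hyb νt b τ := fun b =>
      mul_nonneg measureReal_nonneg (Finset.prod_nonneg fun c _ => hq0 c τ)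
    rcases (hp0 τ).eq_or_lt with hz | hpos
    · have hyb0 : ∀ i b, hyb (ν i) b τ = 0 := by
        intro i b
        have := hsplit b
        rw [← hz, eq_comm, mul_eq_zero] at this
        simp only [hyb]
        rcases this with h0 | h0
        · have : P (R b τ) = 0 := by
            simpa [hq, measureReal_def, ENNReal.toReal_eq_zero_iff] using h0
          rw [hνR, setIntegral_measure_zero _ this, zero_mul]
        · rw [h0, mul_zero]
      simp only [← hz, zero_mul, Finset.sum_const_zero, hyb0, Real.negMulLog_zero, mul_zero,
        sub_zero, add_zero, zero_add]
      exact Finset.sum_nonneg fun b _ => htn b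
    · have hqpos : ∀ b, 0 < q b τ := fun b => lt_of_le_of_ne (hq0 b τ) fun h0 =>
        hpos.ne' (Finset.prod_eq_zero (Finset.mem_univ b) h0.symm)
      let r : Fin k → Fin N → ℝ := fun i b =>
        ∫ x, likelihood (g i) ρ x ∂(ProbabilityTheory.cond P (R b τ))
      have hr : ∀ i b, r i b = (ν i).real (R b τ) / q b τ := by
        intro i b
        simp only [r]
        rw [integral_cond_eq_div, hνR]
      have hprobc : ∀ b, IsProbabilityMeasure (ProbabilityTheory.cond P (R b τ)) := by
        intro b
        refine ProbabilityTheory.cond_isProbabilityMeasure fun h0 => (hqpos b).ne' ?_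
        simp [hq, measureReal_def, h0]
      have hrpos : ∀ i b, 0 < r i b := by
        intro i b
        have := hprobc b
        simp only [r]
        rw [integral_pos_iff_support_of_nonneg (fun x => (hLpos i x).le)
          (integrable_likelihood (h.measurable i) (h.abs_le_one i) ρ _)]
        have e : Function.support (fun x => likelihood (n := n) (g i) ρ x) = Set.univ := by
          ext x; simp [(hLpos i x).ne']
        rw [e]; simp
      have hlog : ∀ i, Real.log (p τ / ∏ b, (ν i).real (R b τ)) = ∑ b, -Real.log (r i b) := by
        intro i
        simp only [hp]
        rw [← Finset.prod_div_distrib, Real.log_prod]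
        · refine Finset.sum_congr rfl fun b _ => ?_
          rw [hr, ← Real.log_inv, inv_div]
        · intro b _
          have h1 := (hrpos i b).ne'
          rw [hr, ne_eq, div_eq_zero_iff, not_or] at h1
          exact div_ne_zero h1.2 h1.1
      have hblock : ∀ b, ∑ i, (r i b - 1 - Real.log (r i b)) ≤
          K * (-Real.log (q b τ) + 1) + νt.real (R b τ) / q b τ := by
        intro b
        have := hprobc b
        have h1 := sum_sub_one_sub_log_le h hρ hρn hk (ProbabilityTheory.cond P (R b τ))
          (hqpos b) (by rw [← hP]; exact cond_le_smul (hqpos b))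
        rw [integral_cond_eq_div, Real.log_inv, ← hνtR] at h1
        exact h1
      have hlogp : Real.log (p τ) = ∑ b, Real.log (q b τ) :=
        Real.log_prod fun b _ => (hqpos b).ne'
      have hhyb : ∀ m : Measure (Fin n → Ω), ∀ b, hyb m b τ = p τ * (m.real (R b τ) / q b τ) := by
        intro m b
        have := (hqpos b).ne'
        rw [hsplit b]
        simp only [hyb]
        field_simp
      -- Adds and subtracts r - 1 in each block; the compensating terms p - hyb cancel after
      -- summation over `τ`.
      calc ∑ i, p τ * Real.log (p τ / ∏ b, (ν i).real (R b τ))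
          = ∑ b, ∑ i, (p τ - hyb (ν i) b τ) +
            p τ * ∑ b, ∑ i, (r i b - 1 - Real.log (r i b)) := by
              rw [Finset.mul_sum, ← Finset.sum_add_distrib]
              simp_rw [hlog, Finset.mul_sum, ← Finset.sum_add_distrib]
              rw [Finset.sum_comm]
              refine Finset.sum_congr rfl fun b _ => Finset.sum_congr rfl fun i _ => ?_
              rw [hhyb, ← hr]; ring
        _ ≤ ∑ b, ∑ i, (p τ - hyb (ν i) b τ) +
            p τ * ∑ b, (K * (-Real.log (q b τ) + 1) + νt.real (R b τ) / q b τ) := by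
              gcongr with b _
              exact hblock b
        _ = _ := by
              simp_rw [hhyb νt]
              rw [Finset.sum_add_distrib, ← Finset.mul_sum, ← Finset.mul_sum,
                Finset.sum_add_distrib, Finset.sum_neg_distrib, ← hlogp, Real.negMulLog]
              simp only [Finset.sum_const, Finset.card_univ, Fintype.card_fin, nsmul_eq_mul]
              ring
  rw [Finset.sum_comm]
  refine (Finset.sum_le_sum fun τ _ => hpoint τ).trans ?_
  rw [Finset.sum_add_distrib, Finset.sum_add_distrib]
  have e1 : ∑ τ, ∑ b, ∑ i, (p τ - hyb (ν i) b τ) = 0 := by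
    rw [Finset.sum_comm]
    refine Finset.sum_eq_zero fun b _ => ?_
    rw [Finset.sum_comm]
    refine Finset.sum_eq_zero fun i _ => ?_
    rw [Finset.sum_sub_distrib, hp1, hrect.sum_hybrid P (ν i) b]
    simp
  have e2 : ∑ τ, K * (Real.negMulLog (p τ) + N * p τ) ≤
      K * (Real.log (Fintype.card T) + N) := by
    rw [← Finset.mul_sum, Finset.sum_add_distrib, ← Finset.mul_sum, hp1, mul_one]
    gcongr
    exact sum_negMulLog_le hp0 hp1
  have e3 : ∑ τ, ∑ b, hyb νt b τ ≤ N * K := by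
    rw [Finset.sum_comm]
    calc _ = ∑ _b : Fin N, νt.real Set.univ :=
          Finset.sum_congr rfl fun b _ => hrect.sum_hybrid P νt b
      _ = N * νt.real Set.univ := by simp
      _ ≤ N * K := by gcongr
  rw [e1]
  linarith

theorem card_le_of_identifies [Nonempty T] [IsProbabilityMeasure μ₀]
    (h : IsNearlyIndependent μ₀ g n)
    (hρ : 0 < ρ) (hρn : ρ * √n ≤ 1 / 16) (hk : 2 ≤ k)
    (hρk : (ρ * √n) ^ 2 * Real.log k ≤ 1 / 64) (hrect : IsRectangular tr R)
    {ν : Fin k → Measure (Fin n → Ω)} [∀ i, IsProbabilityMeasure (ν i)]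
    (hν : ∀ i, ν i = (Measure.pi fun _ : Fin n => μ₀).withDensity fun x =>
      ENNReal.ofReal (likelihood (g i) ρ x))
    (out : T → Fin k)
    (hout : ∀ i, 2 / 3 ≤ (Measure.pi fun _ : Fin N => ν i).real {X | out (tr X) = i}) :
    (k : ℝ) / 100 ≤
      131072 * ((ρ * √n) ^ 2 * Real.log k) * (Real.log (Fintype.card T) + 2 * N) := by
  refine le_trans ?_ (sum_relEntropy_le h hρ hρn hk hρk hrect rfl hν)
  set P := Measure.pi fun _ : Fin n => μ₀
  have hac : ∀ i (S : Set (Fin n → Ω)), MeasurableSet S → (ν i).real S = 0 → P.real S = 0 := by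
    have hs1 : (1 : ℝ) ≤ √n := by rw [Real.one_le_sqrt]; exact_mod_cast h.one_le
    have hρ2 : |ρ| ≤ 1 / 2 := by rw [abs_of_pos hρ]; nlinarith
    intro i S hS h0
    have h1 : ν i S = 0 := by simpa [measureReal_def, ENNReal.toReal_eq_zero_iff] using h0
    rw [hν i, withDensity_apply_eq_zero
      (measurable_likelihood (h.measurable i) ρ).ennreal_ofReal] at h1
    have h2 : {x : Fin n → Ω | ENNReal.ofReal (likelihood (g i) ρ x) ≠ 0} = Set.univ := by
      ext x
      simpa using likelihood_pos (h.abs_le_one i) hρ2 x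
    rw [h2, Set.univ_inter] at h1
    simp [measureReal_def, h1]
  have hlow : ∀ i, Real.log 2 * (1 - ∑ τ with out τ = i, ∏ b, P.real (R b τ)) - 1 / 3 ≤
      ∑ τ, (∏ b, P.real (R b τ)) *
        Real.log ((∏ b, P.real (R b τ)) / ∏ b, (ν i).real (R b τ)) := by
    intro i
    refine le_sum_mul_log_div (fun τ => Finset.prod_nonneg fun _ _ => measureReal_nonneg)
      (fun τ => Finset.prod_nonneg fun _ _ => measureReal_nonneg) (fun τ h0 => ?_) ?_ ?_ _ ?_
    · obtain ⟨b, -, hb⟩ := Finset.prod_eq_zero_iff.1 h0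
      exact Finset.prod_eq_zero (Finset.mem_univ b) (hac i _ (hrect.measurableSet b τ) hb)
    · simpa using hrect.sum_prod fun _ => P
    · simpa using hrect.sum_prod fun _ => ν i
    · rw [hrect.sum_filter_prod fun _ => ν i]
      exact hout i
  refine le_trans ?_ (Finset.sum_le_sum fun i _ => hlow i)
  have hone : ∑ i, ∑ τ with out τ = i, ∏ b, P.real (R b τ) = 1 := by
    rw [Finset.sum_fiberwise]
    simpa using hrect.sum_prod fun _ => P
  rw [Finset.sum_sub_distrib, ← Finset.mul_sum, Finset.sum_sub_distrib, hone]
  simp only [Finset.sum_const, Finset.card_univ, Fintype.card_fin, nsmul_eq_mul, mul_one]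
  -- For k ≥ 2, log 2 · (k - 1) - k/3 ≥ (log 2 / 2 - 1/3) k, and the bracket exceeds 1/100.
  have := Real.log_two_gt_d9
  have hk' : (2 : ℝ) ≤ k := by exact_mod_cast hk
  nlinarith

end Information

/-! ### Streaming algorithms as protocols on blocks of samples -/

namespace StreamAlg

variable {Ω : Type*} [MeasurableSpace Ω] {s k : ℕ}

/-- The memory after `m` further steps, starting at time `j₀` from the memory `u`. -/
def evolve (A : StreamAlg Ω s k) (y : ℕ → Ω) (j₀ : ℕ) (u : Fin s → Bool) : ℕ → (Fin s → Bool)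
  | 0 => u
  | m + 1 => A.step (j₀ + m) (y (j₀ + m)) (A.evolve y j₀ u m)

theorem memory_add (A : StreamAlg Ω s k) (y : ℕ → Ω) (j m : ℕ) :
    A.memory y (j + m) = A.evolve y j (A.memory y j) m := by
  induction m with
  | zero => rfl
  | succ m ih => rw [← add_assoc, memory, evolve, ih]

theorem evolve_congr (A : StreamAlg Ω s k) {y z : ℕ → Ω} {j : ℕ} (u : Fin s → Bool) {m : ℕ}
    (h : ∀ i, j ≤ i → i < j + m → y i = z i) : A.evolve y j u m = A.evolve z j u m := by
  induction m with
  | zero => rfl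
  | succ m ih =>
    rw [evolve, evolve, ih fun i h1 h2 => h i h1 (by omega), h (j + m) (by omega) (by omega)]

theorem measurable_evolve (A : StreamAlg Ω s k) {X : Type*} [MeasurableSpace X] {y : X → ℕ → Ω}
    (hy : ∀ j, Measurable fun x => y x j) (j : ℕ) (u : Fin s → Bool) (m : ℕ) :
    Measurable fun x => A.evolve (y x) j u m := by
  induction m with
  | zero => exact measurable_const
  | succ m ih =>
    have h1 : Measurable fun z : (Fin s → Bool) × Ω => A.step (j + m) z.2 z.1 :=
      measurable_from_prod_countable_right fun v => A.measurable_step (j + m) v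
    exact h1.comp (ih.prodMk (hy (j + m)))

theorem measurableSet_run (A : StreamAlg Ω s k) {t : ℕ} (ht : 1 ≤ t) (ℓ : ℕ) (i : Fin k) :
    MeasurableSet {x : Fin t → Ω | A.run ht ℓ x = i} := by
  have h1 : Measurable fun x : Fin t → Ω =>
      A.memory (fun j => x ⟨j % t, Nat.mod_lt j ht⟩) (t * ℓ) := by
    have h2 := A.measurable_evolve (y := fun (x : Fin t → Ω) j => x ⟨j % t, Nat.mod_lt j ht⟩)
      (fun j => measurable_pi_apply _) 0 A.init (t * ℓ)
    have h3 : ∀ x : Fin t → Ω, A.memory (fun j => x ⟨j % t, Nat.mod_lt j ht⟩) (t * ℓ) =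
        A.evolve (fun j => x ⟨j % t, Nat.mod_lt j ht⟩) 0 A.init (t * ℓ) := by
      intro x
      have := A.memory_add (fun j => x ⟨j % t, Nat.mod_lt j ht⟩) 0 (t * ℓ)
      rw [zero_add] at this
      exact this
    simp_rw [h3]
    exact h2
  exact h1 (Set.toFinite (A.output ⁻¹' {i})).measurableSet

end StreamAlg

/-- The samples contained in a sequence of `N` blocks of size `n`. -/
def unblock {Ω : Type*} {N n t : ℕ} (hn : 1 ≤ n) (htN : t ≤ N * n) (X : Fin N → Fin n → Ω)
    (j : Fin t) : Ω :=
  X ⟨j / n, Nat.div_lt_of_lt_mul (by rw [mul_comm]; omega)⟩ ⟨j % n, Nat.mod_lt _ hn⟩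

theorem map_unblock {Ω : Type*} [MeasurableSpace Ω] {N n t : ℕ} (hn : 1 ≤ n) (htN : t ≤ N * n)
    (ν : Measure Ω) [IsProbabilityMeasure ν] :
    MeasurePreserving (unblock hn htN)
      (Measure.pi fun _ : Fin N => Measure.pi fun _ : Fin n => ν)
      (Measure.pi fun _ : Fin t => ν) := by
  have hmeas : Measurable (unblock (Ω := Ω) hn htN) := by
    refine measurable_pi_lambda _ fun j => ?_
    exact (measurable_pi_apply _).comp (measurable_pi_apply _)
  refine ⟨hmeas, (Measure.pi_eq fun S hS => ?_).symm⟩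
  rw [Measure.map_apply hmeas (MeasurableSet.univ_pi hS)]
  -- Positions at or beyond `t` are never read, hence unconstrained and of factor 1.
  let S' : Fin N → Fin n → Set Ω := fun b c =>
    if h : (b : ℕ) * n + c < t then S ⟨b * n + c, h⟩ else Set.univ
  have hpre : unblock hn htN ⁻¹' Set.univ.pi S =
      Set.univ.pi fun b => Set.univ.pi fun c => S' b c := by
    ext X
    simp only [Set.mem_preimage, Set.mem_pi, Set.mem_univ, true_implies, S', unblock]
    constructor
    · intro h b c
      split_ifs with hbc
      · have := h ⟨b * n + c, hbc⟩
        have e1 : ((b : ℕ) * n + c) / n = b := by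
          rw [mul_comm, Nat.mul_add_div (by omega), Nat.div_eq_of_lt c.2, add_zero]
        have e2 : ((b : ℕ) * n + c) % n = c := by
          rw [mul_comm, Nat.mul_add_mod, Nat.mod_eq_of_lt c.2]
        simpa only [e1, e2] using this
      · trivial
    · intro h j
      have := h ⟨j / n, Nat.div_lt_of_lt_mul (by rw [mul_comm]; omega)⟩ ⟨j % n, Nat.mod_lt _ hn⟩
      have e : (j : ℕ) / n * n + j % n = j := Nat.div_add_mod' _ _
      simp only [e, Fin.is_lt, dif_pos] at this
      exact this
  rw [hpre, Measure.pi_pi]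
  simp_rw [Measure.pi_pi]
  rw [← Fintype.prod_prod_type' fun b c => ν (S' b c)]
  symm
  refine Fintype.prod_of_injective (fun j : Fin t => ((⟨j / n, Nat.div_lt_of_lt_mul
    (by rw [mul_comm]; omega)⟩, ⟨j % n, Nat.mod_lt _ hn⟩) : Fin N × Fin n)) ?_ _ _ ?_ ?_
  · intro i j hij
    simp only [Prod.mk.injEq, Fin.mk.injEq] at hij
    ext
    rw [← Nat.div_add_mod' i n, ← Nat.div_add_mod' j n, hij.1, hij.2]
  · rintro ⟨b, c⟩ hbc
    have : ¬ ((b : ℕ) * n + c < t) := by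
      intro h
      refine hbc ⟨⟨b * n + c, h⟩, ?_⟩
      have e1 : ((b : ℕ) * n + c) / n = b := by
        rw [mul_comm, Nat.mul_add_div (by omega), Nat.div_eq_of_lt c.2, add_zero]
      have e2 : ((b : ℕ) * n + c) % n = c := by
        rw [mul_comm, Nat.mul_add_mod, Nat.mod_eq_of_lt c.2]
      simp only [e1, e2]
    simp [S', this]
  · intro j
    have e : (j : ℕ) / n * n + j % n = j := Nat.div_add_mod' _ _
    simp only [S', e, Fin.is_lt, dif_pos]

/-- The starting time of the `q`-th block visit, when `t` samples are read in `N` blocks of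
size `n`, repeatedly. -/
def blockTime (t n N q : ℕ) : ℕ := q / N * t + min (q % N * n) t

/-- Expresses the end of visit `q` within its own pass, even if it is the last of the pass: the
minimum is then `t`, which is where the next pass starts. -/
theorem blockTime_succ {t n N : ℕ} (hN : 1 ≤ N) (htN : t ≤ N * n) (q : ℕ) :
    blockTime t n N (q + 1) = q / N * t + min ((q % N + 1) * n) t := by
  have hq := Nat.mod_lt q hN
  unfold blockTime
  rcases Nat.lt_or_ge (q % N + 1) N with h | h
  · have e : q + 1 = N * (q / N) + (q % N + 1) := by
      have := Nat.div_add_mod q N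
      omega
    have e1 : (q + 1) % N = q % N + 1 := by
      rw [e, Nat.mul_add_mod, Nat.mod_eq_of_lt h]
    have e2 : (q + 1) / N = q / N := by
      conv_lhs => rw [e, Nat.mul_add_div hN, Nat.div_eq_of_lt h, add_zero]
    rw [e1, e2]
  · have e0 : q % N + 1 = N := by omega
    have e3 : q + 1 = N * (q / N + 1) := by
      have := Nat.div_add_mod q N
      rw [mul_add]; omega
    rw [e0, e3, Nat.mul_mod_right, Nat.mul_div_cancel_left _ hN, min_eq_right htN]
    simp [add_mul]

theorem blockTime_le_succ {t n N : ℕ} (hN : 1 ≤ N) (htN : t ≤ N * n) (q : ℕ) :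
    blockTime t n N q ≤ blockTime t n N (q + 1) := by
  rw [blockTime_succ hN htN, blockTime]
  gcongr
  omega

theorem div_eq_of_blockTime_le {t n N : ℕ} (hN : 1 ≤ N) (htN : t ≤ N * n)
    {q m : ℕ} (h1 : blockTime t n N q ≤ m) (h2 : m < blockTime t n N (q + 1)) :
    m % t / n = q % N := by
  rw [blockTime_succ hN htN] at h2
  rw [blockTime] at h1
  obtain ⟨m', rfl⟩ := Nat.exists_eq_add_of_le (show q / N * t ≤ m by omega)
  have h3 : min (q % N * n) t ≤ m' := by omega
  have h4 : m' < min ((q % N + 1) * n) t := by omega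
  have h5 : m' < t := by omega
  have h6 : q % N * n ≤ m' := by omega
  rw [Nat.mul_add_mod_self_right, Nat.mod_eq_of_lt h5]
  exact Nat.div_eq_of_lt_le h6 (by omega)

namespace StreamAlg

variable {Ω : Type*} [MeasurableSpace Ω] {s k : ℕ}

/-- The stream seen by an algorithm making passes over the samples contained in blocks. -/
def blockStream {N n t : ℕ} (hn : 1 ≤ n) (ht : 1 ≤ t) (htN : t ≤ N * n)
    (X : Fin N → Fin n → Ω) (j : ℕ) : Ω :=
  unblock hn htN X ⟨j % t, Nat.mod_lt j ht⟩

/-- The memory at the start of the `q`-th block visit, as recorded by a transcript. -/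
def recorded (A : StreamAlg Ω s k) {M : ℕ} (τ : Fin M → (Fin s → Bool)) (q : ℕ) : Fin s → Bool :=
  if h : 1 ≤ q ∧ q - 1 < M then τ ⟨q - 1, h.2⟩ else A.init

/-- The memories at the ends of the block visits. -/
def blockTranscript (A : StreamAlg Ω s k) {N n t : ℕ} (hn : 1 ≤ n) (ht : 1 ≤ t)
    (htN : t ≤ N * n) (M : ℕ) (X : Fin N → Fin n → Ω) (q : Fin M) : Fin s → Bool :=
  A.memory (blockStream hn ht htN X) (blockTime t n N (q + 1))

/-- The contents of block `b` that are consistent with a transcript. -/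
def blockSet (A : StreamAlg Ω s k) {n : ℕ} (hn : 1 ≤ n) (t N M : ℕ) (b : Fin N)
    (τ : Fin M → (Fin s → Bool)) : Set (Fin n → Ω) :=
  {x | ∀ q : Fin M, (q : ℕ) % N = b →
    A.evolve (fun j => x ⟨j % t % n, Nat.mod_lt _ hn⟩) (blockTime t n N q) (A.recorded τ q)
      (blockTime t n N (q + 1) - blockTime t n N q) = τ q}

/-- Once the memory before a visit is read off the transcript, consistency of that visit depends
only on the block visited. Grouping the visits by block gives the rectangle; conversely,
visit-by-visit consistency determines the run by induction. -/
theorem isRectangular_blockTranscript (A : StreamAlg Ω s k) {N n t : ℕ} (hn : 1 ≤ n) (ht : 1 ≤ t)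
    (hN : 1 ≤ N) (htN : t ≤ N * n) (M : ℕ) :
    IsRectangular (A.blockTranscript hn ht htN M) (A.blockSet hn t N M) := by
  have hstep : ∀ X q, A.memory (blockStream hn ht htN X) (blockTime t n N (q + 1)) =
      A.evolve (fun j => X ⟨q % N, Nat.mod_lt _ hN⟩ ⟨j % t % n, Nat.mod_lt _ hn⟩)
        (blockTime t n N q) (A.memory (blockStream hn ht htN X) (blockTime t n N q))
        (blockTime t n N (q + 1) - blockTime t n N q) := by
    intro X q
    have hle := blockTime_le_succ hN htN q
    conv_lhs => rw [← Nat.add_sub_of_le hle, memory_add]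
    refine A.evolve_congr _ fun i h1 h2 => ?_
    have := div_eq_of_blockTime_le hN htN h1 (by omega)
    simp only [blockStream, unblock, this]
  have hzero : blockTime t n N 0 = 0 := by simp [blockTime]
  refine ⟨fun b τ => ?_, fun X τ => ⟨?_, fun h => ?_⟩⟩
  · have : A.blockSet hn t N M b τ = ⋂ q : Fin M, ⋂ _ : (q : ℕ) % N = b,
        (fun x : Fin n → Ω => A.evolve (fun j => x ⟨j % t % n, Nat.mod_lt _ hn⟩)
          (blockTime t n N q) (A.recorded τ q)
          (blockTime t n N (q + 1) - blockTime t n N q)) ⁻¹' {τ q} := by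
      ext x; simp [blockSet]
    rw [this]
    exact MeasurableSet.iInter fun q => MeasurableSet.iInter fun _ =>
      A.measurable_evolve (y := fun (x : Fin n → Ω) j => x ⟨j % t % n, Nat.mod_lt _ hn⟩)
        (fun j => measurable_pi_apply _) _ _ _ (measurableSet_singleton _)
  · rintro rfl b q hq
    have hrec : A.recorded (A.blockTranscript hn ht htN M X) q =
        A.memory (blockStream hn ht htN X) (blockTime t n N q) := by
      rcases Nat.eq_zero_or_pos q with h0 | h0
      · rw [recorded, dif_neg (by omega), h0, hzero]; rfl
      · rw [recorded, dif_pos ⟨h0, by omega⟩, blockTranscript]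
        simp only [Nat.sub_add_cancel h0]
    have hb : (⟨(q : ℕ) % N, Nat.mod_lt _ hN⟩ : Fin N) = b := Fin.ext hq
    rw [hrec, blockTranscript, hstep X q, hb]
  · have key : ∀ q, ∀ hq : q < M, A.blockTranscript hn ht htN M X ⟨q, hq⟩ = τ ⟨q, hq⟩ := by
      intro q
      induction q with
      | zero =>
        intro hq
        rw [← h ⟨0 % N, Nat.mod_lt _ hN⟩ ⟨0, hq⟩ rfl, blockTranscript, hstep, recorded,
          dif_neg (by simp)]
        simp only [hzero]; rfl
      | succ q ih =>
        intro hq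
        rw [← h ⟨(q + 1) % N, Nat.mod_lt _ hN⟩ ⟨q + 1, hq⟩ rfl, blockTranscript, hstep, recorded,
          dif_pos ⟨by simp, by simp; omega⟩]
        simp only [Nat.add_sub_cancel]
        rw [← ih (by omega)]; rfl
    funext q
    exact key q q.2

/-- The output of the algorithm, as a function of the transcript. -/
def transcriptOutput (A : StreamAlg Ω s k) {M : ℕ} (τ : Fin M → (Fin s → Bool)) : Fin k :=
  A.output (A.recorded τ M)

theorem transcriptOutput_blockTranscript (A : StreamAlg Ω s k) {N n t ℓ : ℕ} (hn : 1 ≤ n)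
    (ht : 1 ≤ t) (hN : 1 ≤ N) (hℓ : 1 ≤ ℓ) (htN : t ≤ N * n) (X : Fin N → Fin n → Ω) :
    A.transcriptOutput (A.blockTranscript hn ht htN (ℓ * N) X) =
      A.run ht ℓ (unblock hn htN X) := by
  have hM : 1 ≤ ℓ * N := Nat.mul_pos hℓ hN
  rw [transcriptOutput, recorded, dif_pos ⟨hM, by omega⟩, run, blockTranscript]
  simp only [Nat.sub_add_cancel hM]
  have : blockTime t n N (ℓ * N) = t * ℓ := by
    rw [blockTime, Nat.mul_div_cancel _ hN, Nat.mul_mod_left, zero_mul, Nat.zero_min, add_zero,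
      mul_comm]
  rw [this]
  rfl

end StreamAlg

/-! ### The lower bound -/

theorem IsCenteredFamily.exists_nearlyIndependent {Ω : Type*} [MeasurableSpace Ω] {k n : ℕ}
    {ρ : ℝ} {μ₀ : Measure Ω} {μ : Fin k → Measure Ω} (h : IsCenteredFamily ρ μ₀ μ) (hn : 1 ≤ n)
    (hρ : ρ ≤ 1 / 2) (hu : ApproxUncorrelated ρ μ₀ μ n) :
    ∃ g : Fin k → Ω → ℝ, IsNearlyIndependent μ₀ g n ∧
      ∀ i, μ i = μ₀.withDensity fun a => ENNReal.ofReal (1 + ρ * g i a) := by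
  obtain ⟨g, hg, hg1, hμ, hcorr⟩ := h.exists_density
  have := h.prob_center
  have := h.prob
  have hρ0 := h.rho_pos
  have hn0 : (0 : ℝ) < n := by exact_mod_cast hn
  have hint : ∀ i, Integrable (g i) μ₀ := fun i =>
    Integrable.of_bound (hg i).aestronglyMeasurable 1 (Filter.Eventually.of_forall (hg1 i))
  have hzero : ∀ i, ∫ a, g i a ∂μ₀ = 0 := by
    intro i
    have h1 := measureReal_withDensity_ofReal (P := μ₀) (f := fun a => 1 + ρ * g i a)
      ((integrable_const _).add ((hint i).const_mul _))
      (fun a => (one_add_mul_pos (hg1 i) (by rwa [abs_of_pos hρ0]) a).le) MeasurableSet.univ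
    rw [← hμ i, setIntegral_univ, integral_add (integrable_const _) ((hint i).const_mul _),
      integral_const_mul] at h1
    simp only [probReal_univ, integral_const, smul_eq_mul, mul_one] at h1
    have : ρ * ∫ a, g i a ∂μ₀ = 0 := by linarith
    exact (mul_eq_zero.1 this).resolve_left hρ0.ne'
  refine ⟨g, ⟨hg, hg1, hzero, hn, ?_⟩, hμ⟩
  rw [← Finset.sum_filter_add_sum_filter_not Finset.univ fun S : Finset (Fin k) => 2 ≤ S.card,
    add_comm]
  -- The empty set contributes 1, singletons contribute 0 since the `g i` are centered, and the rest
  -- is the hypothesis rescaled.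
  refine add_le_add (le_of_eq ?_) (le_trans (le_of_eq ?_) hu)
  · rw [Finset.sum_eq_single (∅ : Finset (Fin k))]
    · simp
    · intro S hS hne
      have h1 : S.card = 1 := by
        have h2 := Finset.card_pos.2 (Finset.nonempty_iff_ne_empty.2 hne)
        have h3 := (Finset.mem_filter.1 hS).2
        omega
      obtain ⟨i, rfl⟩ := Finset.card_eq_one.1 h1
      simp [hzero i]
    · intro hne
      simp at hne
  · refine Finset.sum_congr rfl fun S _ => ?_
    rw [hcorr S, abs_mul, abs_of_pos (pow_pos hρ0 _), ← mul_assoc, mul_assoc _ _ (ρ ^ S.card)]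
    have e1 : ρ ^ (-(S.card : ℝ)) * ρ ^ S.card = 1 := by
      rw [Real.rpow_neg hρ0.le, Real.rpow_natCast]
      exact inv_mul_cancel₀ (pow_pos hρ0 _).ne'
    have e2 : (n : ℝ) ^ (-(S.card : ℝ) / 2) = (1 / √(n : ℝ)) ^ S.card := by
      rw [one_div, Real.sqrt_eq_rpow, ← Real.rpow_neg hn0.le, ← Real.rpow_natCast,
        ← Real.rpow_mul hn0.le]
      congr 1; ring
    rw [e1, e2, mul_one]

/-- Identifying a member of the family requires of the order of `ρ⁻²` samples. -/
theorem le_sq_mul_of_identifies {Ω : Type*} [MeasurableSpace Ω] {k t : ℕ} {ρ : ℝ}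
    {μ₀ : Measure Ω} [IsProbabilityMeasure μ₀] {g : Fin k → Ω → ℝ} (hk : 2 ≤ k)
    (hg : ∀ i, Measurable (g i)) (hg1 : ∀ i a, |g i a| ≤ 1) (h0 : ∀ i, ∫ a, g i a ∂μ₀ = 0)
    (hρ : |ρ| ≤ 1 / 2) {ν : Fin k → Measure (Fin t → Ω)} [∀ i, IsProbabilityMeasure (ν i)]
    (hν : ∀ i, ν i = (Measure.pi fun _ : Fin t => μ₀).withDensity fun x =>
      ENNReal.ofReal (likelihood (g i) ρ x))
    (out : (Fin t → Ω) → Fin k) (hmeas : ∀ i, MeasurableSet {x | out x = i})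
    (hout : ∀ i, 2 / 3 ≤ (ν i).real {x | out x = i}) : 1 / 200 ≤ ρ ^ 2 * t := by
  classical
  set P := Measure.pi fun _ : Fin t => μ₀
  have hLpos : ∀ i x, 0 < likelihood (n := t) (g i) ρ x :=
    fun i x => likelihood_pos (hg1 i) hρ x
  have hLint : ∀ i, Integrable (likelihood (g i) ρ) P := fun i =>
    integrable_likelihood (hg i) (hg1 i) ρ P
  have hgint : ∀ i (j : Fin t), Integrable (fun x : Fin t → Ω => g i (x j)) P := fun i j =>
    Integrable.of_bound ((hg i).comp (measurable_pi_apply j)).aestronglyMeasurable 1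
      (Filter.Eventually.of_forall fun x => hg1 i _)
  have hgzero : ∀ i, ∫ x, (ρ * ∑ j, g i (x j)) ∂P = 0 := by
    intro i
    rw [integral_const_mul, integral_finsetSum _ fun j _ => hgint i j]
    have : ∀ j : Fin t, ∫ x, g i (x j) ∂P = 0 := by
      intro j
      have hmp := measurePreserving_eval (fun _ : Fin t => μ₀) j
      rw [← h0 i, ← hmp.map_eq, integral_map hmp.measurable.aemeasurable
        (hg i).aestronglyMeasurable]
    simp [this]
  -- The test of `le_sum_mul_log_div`, on the whole sample. The relative entropy is at most 2ρ²t
  -- since -log L ≤ 2ρ²t - ρ Σ g(x_j), whose linear part has mean zero.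
  have key : ∀ i, Real.log 2 * (1 - P.real {x | out x = i}) - 1 / 3 ≤ 2 * ρ ^ 2 * t := by
    intro i
    set E := {x | out x = i}
    have hEm : MeasurableSet E := hmeas i
    have hνE : (ν i).real E = ∫ x in E, likelihood (g i) ρ x ∂P := by
      rw [hν i]
      exact measureReal_withDensity_ofReal (hLint i) (fun x => (hLpos i x).le) hEm
    have hνu : ∫ x, likelihood (g i) ρ x ∂P = 1 := by
      rw [← setIntegral_univ, ← measureReal_withDensity_ofReal (hLint i)
        (fun x => (hLpos i x).le) MeasurableSet.univ, ← hν i, probReal_univ]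
    have hI1 : Integrable (E.indicator fun _ => Real.log 2) P :=
      (integrable_const _).indicator hEm
    have hI2 : Integrable (E.indicator fun x => likelihood (g i) ρ x) P :=
      (hLint i).indicator hEm
    have hS : Integrable (fun x : Fin t → Ω => ρ * ∑ j, g i (x j)) P :=
      (integrable_finsetSum _ fun j _ => hgint i j).const_mul _
    have hpt : ∀ x, (Real.log 2 + 1 - E.indicator (fun _ => Real.log 2) x) -
        (2 * likelihood (g i) ρ x - E.indicator (fun x => likelihood (g i) ρ x) x) ≤
        2 * ρ ^ 2 * t - ρ * ∑ j, g i (x j) := by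
      intro x
      have h1 := le_log_likelihood (hg1 i) hρ x
      by_cases hx : x ∈ E
      · rw [Set.indicator_of_mem hx, Set.indicator_of_mem hx]
        have := Real.log_le_sub_one_of_pos (hLpos i x)
        linarith
      · rw [Set.indicator_of_notMem hx, Set.indicator_of_notMem hx]
        have h2 := Real.log_le_sub_one_of_pos (mul_pos two_pos (hLpos i x))
        rw [Real.log_mul (by norm_num) (hLpos i x).ne'] at h2
        linarith
    have hJ1 : Integrable (fun x => Real.log 2 + 1 - E.indicator (fun _ => Real.log 2) x) P :=
      (integrable_const _).sub hI1
    have hJ2 : Integrable (fun x => 2 * likelihood (g i) ρ x -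
        E.indicator (fun x => likelihood (g i) ρ x) x) P := ((hLint i).const_mul 2).sub hI2
    have hm := integral_mono (hJ1.sub hJ2) ((integrable_const _).sub hS) hpt
    have eL : ∫ x, ((Real.log 2 + 1 - E.indicator (fun _ => Real.log 2) x) -
        (2 * likelihood (g i) ρ x - E.indicator (fun x => likelihood (g i) ρ x) x)) ∂P =
        (Real.log 2 + 1 - P.real E * Real.log 2) - (2 - (ν i).real E) := by
      rw [integral_sub hJ1 hJ2, integral_sub (integrable_const _) hI1,
        integral_sub ((hLint i).const_mul 2) hI2, integral_indicator hEm,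
        integral_indicator hEm, integral_const_mul, hνu, hνE]
      simp
    have eR : ∫ x, (2 * ρ ^ 2 * t - ρ * ∑ j, g i (x j)) ∂P = 2 * ρ ^ 2 * t := by
      rw [integral_sub (integrable_const _) hS, hgzero i]
      simp
    have hm' := (eL.symm.le.trans hm).trans eR.le
    have := hout i
    linarith
  have hone : ∑ i, P.real {x | out x = i} = 1 := by
    have := sum_measureReal_preimage_singleton (μ := P) (f := out) Finset.univ
      (fun i _ => hmeas i)
    simp only [Finset.coe_univ, Set.preimage_univ, probReal_univ] at this
    exact this
  have hsum := Finset.sum_le_sum fun i (_ : i ∈ Finset.univ) => key i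
  rw [Finset.sum_sub_distrib, ← Finset.mul_sum, Finset.sum_sub_distrib, hone] at hsum
  simp only [Finset.sum_const, Finset.card_univ, Fintype.card_fin, nsmul_eq_mul, mul_one] at hsum
  have hlog := Real.log_two_gt_d9
  have hk' : (2 : ℝ) ≤ k := by exact_mod_cast hk
  have h3 : (k : ℝ) / 100 ≤ k * (2 * ρ ^ 2 * t) := by nlinarith
  have h4 : (k : ℝ) * (1 / 100) ≤ k * (2 * ρ ^ 2 * t) := by linarith
  have h5 := le_of_mul_le_mul_left h4 (by linarith)
  linarith

theorem theorem2 :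
    ∃ C₂ C₃ : ℝ, 0 < C₂ ∧ 0 < C₃ ∧
      ∀ (Ω : Type*) [MeasurableSpace Ω] (k : ℕ) (ρ : ℝ)
        (μ₀ : MeasureTheory.Measure Ω) (μ : Fin k → MeasureTheory.Measure Ω),
        IsCenteredFamily ρ μ₀ μ →
        (∃ n : ℕ, 1 ≤ n ∧ (n : ℝ) ≤ C₂ / (ρ ^ 2 * Real.log k) ∧
          ApproxUncorrelated ρ μ₀ μ n) →
        ∀ (t s ℓ : ℕ) (ht : 1 ≤ t), 1 ≤ s → 1 ≤ ℓ →
          ∀ A : StreamAlg Ω s k, A.Identifies ht ℓ μ (1 / 3) →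
            (k : ℝ) / (C₃ * ρ ^ 2 * Real.log k) ≤ (t : ℝ) * s * ℓ := by
  -- As log k ≥ 1/2, the first constant gives nρ² ≤ 1/512, enough for ρ√n ≤ 1/16. The second exceeds
  -- 100 · 131072 · 3 · 2.
  refine ⟨1 / 1024, 10 ^ 8, by norm_num, by norm_num, ?_⟩
  intro Ω _ k ρ μ₀ μ hc ⟨n, hn, hnC, hu⟩ t s ℓ ht hs hℓ A hA
  have := hc.prob_center
  have := hc.prob
  have hk := hc.two_le
  have hρ := hc.rho_pos
  have hlogk := half_le_log hk
  have hn0 : (0 : ℝ) < n := by exact_mod_cast hn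
  have hn1 : (1 : ℝ) ≤ n := by exact_mod_cast hn
  have hsq : (ρ * √n) ^ 2 = n * ρ ^ 2 := by
    rw [mul_pow, Real.sq_sqrt hn0.le]; ring
  have hε : n * ρ ^ 2 * Real.log k ≤ 1 / 1024 := by
    rw [le_div_iff₀ (by positivity)] at hnC
    linarith
  have hnρ : n * ρ ^ 2 ≤ 1 / 512 := by
    have : 0 ≤ n * ρ ^ 2 := by positivity
    nlinarith
  have hρn : ρ * √n ≤ 1 / 16 := by
    refine abs_le_of_sq_le_sq' ?_ (by norm_num) |>.2
    rw [hsq]; linarith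
  have hs1 : (1 : ℝ) ≤ √n := by rw [Real.one_le_sqrt]; exact_mod_cast hn
  have hρ2 : ρ ≤ 1 / 2 := by nlinarith
  have hρa : |ρ| ≤ 1 / 2 := by rwa [abs_of_pos hρ]
  obtain ⟨g, hg, hμ⟩ := hc.exists_nearlyIndependent hn hρ2 hu
  have hprobd : ∀ i, IsProbabilityMeasure
      (μ₀.withDensity fun a => ENNReal.ofReal (1 + ρ * g i a)) := fun i => by
    rw [← hμ i]; infer_instance
  have hdens : ∀ (m : ℕ) i, (Measure.pi fun _ : Fin m => μ i) =
      (Measure.pi fun _ : Fin m => μ₀).withDensity fun x =>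
        ENNReal.ofReal (likelihood (g i) ρ x) := by
    intro m i
    have := pi_withDensity_likelihood (n := m) μ₀ (hg.measurable i) (hg.abs_le_one i) hρa
    rw [← this]
    simp_rw [← hμ i]
  have hA' : ∀ i, 2 / 3 ≤ (Measure.pi fun _ : Fin t => μ i).real {x | A.run ht ℓ x = i} := by
    intro i
    have := hA i
    linarith
  -- From nρ² ≤ 1/512 < 1/200 ≤ ρ²t. Without this, rounding up to whole blocks could make Nn much
  -- larger than t.
  have hnt : (n : ℝ) ≤ t := by
    have h1 := le_sq_mul_of_identifies hk hg.measurable hg.abs_le_one hg.integral_eq_zero hρa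
      (fun i => hdens t i) (A.run ht ℓ) (A.measurableSet_run ht ℓ) hA'
    have h2 : ρ ^ 2 * n ≤ ρ ^ 2 * t := by linarith
    exact le_of_mul_le_mul_left h2 (by positivity)
  -- The last block may be partly or wholly unused.
  set N := t / n + 1 with hN
  have hN1 : 1 ≤ N := Nat.succ_pos _
  have htN : t ≤ N * n := by
    have := Nat.lt_div_mul_add (a := t) hn
    rw [hN, add_mul, one_mul]; omega
  have hNn : (N : ℝ) * n ≤ 2 * t := by
    have h1 : N * n ≤ t + n := by
      rw [hN, add_mul, one_mul]
      have := Nat.div_mul_le_self t n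
      omega
    have h2 : (N : ℝ) * n ≤ t + n := by exact_mod_cast h1
    linarith
  have hmain := card_le_of_identifies hg hρ hρn hk (by rw [hsq]; linarith)
    (A.isRectangular_blockTranscript hn ht hN1 htN (ℓ * N)) (fun i => hdens n i)
    A.transcriptOutput (fun i => by
      have hmp := map_unblock hn htN (μ i)
      have h1 := hA' i
      rw [← hmp.measureReal_preimage (A.measurableSet_run ht ℓ i).nullMeasurableSet] at h1
      refine h1.trans_eq (congrArg _ ?_)
      ext X
      simp only [Set.mem_preimage, Set.mem_ofPred_eq]
      rw [A.transcriptOutput_blockTranscript hn ht hN1 hℓ htN])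
  have hcard : Real.log (Fintype.card (Fin (ℓ * N) → Fin s → Bool)) ≤ s * ℓ * N := by
    simp only [Fintype.card_pi, Fintype.card_bool, Finset.prod_const, Finset.card_univ,
      Fintype.card_fin]
    push_cast
    rw [Real.log_pow, Real.log_pow]
    push_cast
    have := Real.log_two_lt_d9
    have h1 : (0 : ℝ) ≤ ℓ * N * s := by positivity
    nlinarith
  have hs' : (1 : ℝ) ≤ s := by exact_mod_cast hs
  have hℓ' : (1 : ℝ) ≤ ℓ := by exact_mod_cast hℓ
  have hsℓ : (1 : ℝ) ≤ s * ℓ := one_le_mul_of_one_le_of_one_le hs' hℓ'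
  have hNsℓ : (N : ℝ) ≤ s * ℓ * N := le_mul_of_one_le_left (by positivity) hsℓ
  rw [hsq] at hmain
  rw [div_le_iff₀ (by positivity)]
  have hL0 : 0 ≤ 131072 * (n * ρ ^ 2 * Real.log k) := by positivity
  calc (k : ℝ) = 100 * (k / 100) := by ring
    _ ≤ 100 * (131072 * (n * ρ ^ 2 * Real.log k) * (3 * (s * ℓ * N))) := by
        gcongr
        refine hmain.trans (mul_le_mul_of_nonneg_left ?_ hL0)
        linarith
    _ = 39321600 * (ρ ^ 2 * Real.log k * s * ℓ) * (N * n) := by ring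
    _ ≤ 39321600 * (ρ ^ 2 * Real.log k * s * ℓ) * (2 * t) := by gcongr
    _ = 78643200 * (t * s * ℓ * ρ ^ 2 * Real.log k) := by ring
    _ ≤ 10 ^ 8 * (t * s * ℓ * ρ ^ 2 * Real.log k) := by
        gcongr
        norm_num
    _ = t * s * ℓ * (10 ^ 8 * ρ ^ 2 * Real.log k) := by ring
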